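/- Let $(X,\mu)$ and $(Y,\mu')$ be Lebesgue probability spaces (standard Borel spaces with probability measures), let $S$ be an automorphism (invertible bimeasurable measure-preserving transformation) of $(X,\mu)$ and $T$ an automorphism of $(Y,\mu')$, and let $n:X\to\mathbb Z$ be a measurable $\mu$-integrable function with $\int_X n\,d\mu=0$. Let $R$ be the skew product $$R(x,y)=(S(x),\,T^{n(x)}(y))$$ on $(X\times Y,\mu\otimes\mu')$, and suppose that $R$ and $T$ are mixing. An automorphism $V$ of a probability space $(Z,\lambda)$ is called mixing if $\lambda(A\cap V^{m}B)\to\lambda(A)\lambda(B)$ as $m\to+\infty$ for all measurable $A,B$. It is said to mix with multiplicity $k$ if for all measurable sets $A_0,\dots,A_k$ and all sequences $m_1,\dots,m_k$ of natural numbers tending to $+\infty$ one has $$\lambda\bigl(A_0\cap V^{m_1}A_1\cap\dots\cap V^{m_1+\dots+m_k}A_k\bigr)\to\lambda(A_0)\lambda(A_1)\cdots\lambda(A_k).$$ It is called tensor simple if for every $N>2$ the product measure $\lambda^{\otimes N}$ is the only $V\times\dots\times V$-invariant measure on $Z^N$ all of whose projections to the $(N-1)$-dimensional faces of $Z^N$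 are equal to $\lambda^{\otimes(N-1)}$. Then: 1. for every natural number $k$, if $S$ mixes with multiplicity $k$, then $R$ mixes with multiplicity $k$; 2. if $S$ is tensor simple, then $R$ is tensor simple. -/

import Mathlib

open MeasureTheory Filter
open scoped Topology

/-- Mixing: `μ (A ∩ Tⁿ B) → μ A * μ B` as `n → ∞`, for all measurable `A`, `B`. -/
def IsMixing {X : Type*} [MeasurableSpace X] (T : X ≃ᵐ X) (μ : Measure X) : Prop :=
  ∀ A B : Set X, MeasurableSet A → MeasurableSet B →
    Tendsto (fun n : ℕ => μ (A ∩ T^[n] '' B)) atTop (𝓝 (μ A * μ B))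

/-- Mixing with multiplicity `k`: for all measurable `A₀, …, A_k` and all sequences
`n₁, …, n_k → ∞`,
`μ (A₀ ∩ T^{n₁} A₁ ∩ ⋯ ∩ T^{n₁ + ⋯ + n_k} A_k) → μ A₀ * μ A₁ * ⋯ * μ A_k`. -/
def MixesWithMultiplicity {X : Type*} [MeasurableSpace X] (T : X ≃ᵐ X) (μ : Measure X)
    (k : ℕ) : Prop :=
  ∀ (A : Fin (k + 1) → Set X) (n : Fin k → ℕ → ℕ),
    (∀ i, MeasurableSet (A i)) → (∀ l, Tendsto (n l) atTop atTop) →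
    Tendsto
      (fun j : ℕ => μ (⋂ i : Fin (k + 1),
        T^[∑ l ∈ Finset.univ.filter (fun l : Fin k => (l : ℕ) < (i : ℕ)), n l j] '' A i))
      atTop (𝓝 (∏ i, μ (A i)))

/-- The class `M(m,n)`: measures on the cube `Xⁿ` all of whose projections to `m`-dimensional
faces are equal to `μ^{⊗ m}`. -/
def InClassM {X : Type*} [MeasurableSpace X] (μ : Measure X) (m n : ℕ)
    (ν : Measure (Fin n → X)) : Prop :=
  ∀ s : Finset (Fin n), s.card = m → ν.map s.restrict = Measure.pi (fun _ : s => μ)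

/-- The class `ID(m,n)`: `μ^{⊗ n}` is the only measure of the class `M(m,n)` which is invariant
under `T × ⋯ × T`. -/
def InClassID {X : Type*} [MeasurableSpace X] (T : X ≃ᵐ X) (μ : Measure X) (m n : ℕ) : Prop :=
  ∀ ν : Measure (Fin n → X), InClassM μ m n ν →
    MeasurePreserving (fun (x : Fin n → X) i => T (x i)) ν ν →
    ν = Measure.pi (fun _ : Fin n => μ)

/-- Tensor simplicity, in the language of joinings: for every `n > 2`, the only
`T × ⋯ × T`-invariant measure on `Xⁿ` with standard projections to all `(n-1)`-dimensional
faces is `μ^{⊗ n}`. -/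
def TensorSimple {X : Type*} [MeasurableSpace X] (T : X ≃ᵐ X) (μ : Measure X) : Prop :=
  ∀ n : ℕ, 2 < n → InClassID T μ (n - 1) n

theorem measurable_zpow_perm {Y : Type*} [MeasurableSpace Y] (T : Y ≃ᵐ Y) (m : ℤ) :
    Measurable (fun y => (T.toEquiv ^ m : Equiv.Perm Y) y) := by
  have h1 : ∀ k : ℕ, Measurable (fun y => (T.toEquiv ^ k : Equiv.Perm Y) y) := by
    intro k
    induction k with
    | zero => exact measurable_id
    | succ k ih =>
      simp only [pow_succ, Equiv.Perm.mul_apply]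
      exact ih.comp T.measurable
  have h2 : ∀ k : ℕ, Measurable (fun y => ((T.toEquiv : Equiv.Perm Y)⁻¹ ^ k) y) := by
    intro k
    induction k with
    | zero => exact measurable_id
    | succ k ih =>
      simp only [pow_succ, Equiv.Perm.mul_apply]
      exact ih.comp T.symm.measurable
  cases m with
  | ofNat k => simpa using h1 k
  | negSucc k =>
    simp only [zpow_negSucc, ← inv_pow]
    exact h2 (k + 1)

theorem measurable_zpow_perm_prod {X Y : Type*} [MeasurableSpace X] [MeasurableSpace Y]
    (T : Y ≃ᵐ Y) {n : X → ℤ} (hn : Measurable n) :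
    Measurable (fun p : X × Y => (T.toEquiv ^ n p.1 : Equiv.Perm Y) p.2) := by
  have h : Measurable (fun q : ℤ × Y => (T.toEquiv ^ q.1 : Equiv.Perm Y) q.2) :=
    measurable_from_prod_countable_right (fun m => measurable_zpow_perm T m)
  exact h.comp ((hn.comp measurable_fst).prodMk measurable_snd)

/-- The skew product `R (x, y) = (S x, T^{n(x)} y)`, an invertible bimeasurable map. -/
def skewProduct {X Y : Type*} [MeasurableSpace X] [MeasurableSpace Y]
    (S : X ≃ᵐ X) (T : Y ≃ᵐ Y) (n : X → ℤ) (hn : Measurable n) : (X × Y) ≃ᵐ (X × Y) where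
  toFun p := (S p.1, (T.toEquiv ^ n p.1 : Equiv.Perm Y) p.2)
  invFun p := (S.symm p.1, (T.toEquiv ^ (-n (S.symm p.1)) : Equiv.Perm Y) p.2)
  left_inv p := by simp
  right_inv p := by simp
  measurable_toFun := (S.measurable.comp measurable_fst).prodMk (measurable_zpow_perm_prod T hn)
  measurable_invFun := (S.symm.measurable.comp measurable_fst).prodMk
    (measurable_zpow_perm_prod T (n := fun x => -n (S.symm x)) (hn.comp S.symm.measurable).neg)

/-! Both assertions reduce to one statement about couplings: an invariant measure `ν` on a finite
power of `X × Y`, with every marginal `μ ⊗ μ'` and with projection to the base coordinates equal to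
a power of `μ`, is itself the product (`eq_pi_of_base_eq_pi`). For tensor simplicity, the base
projection of a measure with standard faces is the product because `S` is tensor simple. For
multiple mixing, `ν` is a limit of the measures carried by the orbit tuples `(R^{-e_i} z)_i`. Limits
exist by compactness of couplings (`exists_tendsto_univ_pi`), and their base projection is the
product because `S` mixes with multiplicity `k`.

The coupling statement rests on a clash between rigidity and mixing. Since `n` has mean zero,
Atkinson's theorem makes the extension `(x, j) ↦ (S x, j + n x)` conservative: almost every point of
a set `A` returns to `A` at infinitely many times `m` with zero cocycle sum, and at these times
`R^m` fixes the fibre coordinate. Couple `R` with a system `Q` so that `(x, z)` has the product law,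
and let `f(x, z)` be the conditional probability that `y ∈ B`. Then `f(S^m x, Q^m z) = f(x, z)`
whenever the sum at time `m` vanishes. If `S^m x` also returns to a set of points with nearly equal
sections, `f(x, ·)` is close to `f(x, Q^m ·)`. Mixing of `Q` then decorrelates `f(x, ·)` from every
mixing set (`ae_setIntegral_eq_of_invariant`), so `(x, y)` is independent of `z`. The fibres are
handled in this way one at a time. -/

/-! ### Approximation in L¹ and mixing of a set against functions -/

/-- The one approximation hypothesis gives both L¹-closedness and invariance under almost everywhere
equality, the latter being approximation at distance zero. -/
theorem integrable_induction_of_approx {Z : Type*} [MeasurableSpace Z] {lam : Measure Z}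
    (P : (Z → ℝ) → Prop)
    (h_ind : ∀ (c : ℝ) ⦃s : Set Z⦄, MeasurableSet s → lam s < ⊤ → P (s.indicator fun _ => c))
    (h_add : ∀ ⦃f g : Z → ℝ⦄, Integrable f lam → Integrable g lam → P f → P g → P (f + g))
    (h_closed : ∀ ⦃f : Z → ℝ⦄, Integrable f lam →
      (∀ ε > 0, ∃ g, Integrable g lam ∧ P g ∧ ∫ z, |f z - g z| ∂lam < ε) → P f) :
    ∀ ⦃f : Z → ℝ⦄, Integrable f lam → P f := by
  refine Integrable.induction P h_ind (fun f g _ hf hg => h_add hf hg) ?_ ?_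
  · refine isClosed_of_closure_subset fun f hf => ?_
    refine h_closed (L1.integrable_coeFn f) fun ε hε => ?_
    obtain ⟨g, hg, hfg⟩ := Metric.mem_closure_iff.1 hf ε hε
    refine ⟨g, L1.integrable_coeFn g, hg, ?_⟩
    rw [dist_eq_norm, L1.norm_eq_integral_norm] at hfg
    refine lt_of_eq_of_lt (integral_congr_ae ?_) hfg
    filter_upwards [Lp.coeFn_sub f g] with z hz
    rw [hz, Pi.sub_apply, Real.norm_eq_abs]
  · intro f g hfg hf hPf
    refine h_closed (hf.congr hfg) fun ε hε => ⟨f, hf, hPf, ?_⟩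
    refine lt_of_eq_of_lt ?_ hε
    rw [integral_eq_zero_of_ae]
    filter_upwards [hfg] with z hz
    simp [hz]

/-- The set `E` is asymptotically independent of `Q⁻ᵐ B`, for every measurable `B`. -/
def MixesSet {Z : Type*} [MeasurableSpace Z] (Q : Z → Z) (lam : Measure Z) (E : Set Z) : Prop :=
  ∀ B : Set Z, MeasurableSet B →
    Tendsto (fun m : ℕ => lam.real (E ∩ Q^[m] ⁻¹' B)) atTop (𝓝 (lam.real E * lam.real B))

theorem image_iterate_eq_preimage {Z : Type*} [MeasurableSpace Z] (T : Z ≃ᵐ Z) (m : ℕ)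
    (B : Set Z) : T^[m] '' B = T.symm^[m] ⁻¹' B :=
  congrFun (Set.image_eq_preimage_of_inverse
    (Function.LeftInverse.iterate T.symm_apply_apply m)
    (Function.LeftInverse.iterate T.apply_symm_apply m)) B

/-- Pull back by the measure-preserving `T^m`: the preimage of `B ∩ T^m E` is `E ∩ T^{-m} B`. -/
theorem IsMixing.mixesSet {Z : Type*} [MeasurableSpace Z] {T : Z ≃ᵐ Z} {lam : Measure Z}
    [IsFiniteMeasure lam] (h : IsMixing T lam) (hT : MeasurePreserving T lam lam)
    {E : Set Z} (hE : MeasurableSet E) : MixesSet T lam E := by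
  intro B hB
  have h1 := (ENNReal.tendsto_toReal (by finiteness)).comp (h B E hB hE)
  rw [ENNReal.toReal_mul, mul_comm] at h1
  refine h1.congr fun m => ?_
  have hTm := hT.iterate m
  have hm : MeasurableSet (T^[m] '' E) := by
    rw [image_iterate_eq_preimage]
    exact (T.symm.measurable.iterate m) hE
  rw [Function.comp_apply, ← hTm.measure_preimage (hB.inter hm).nullMeasurableSet, Measure.real,
    Set.preimage_inter, Set.preimage_image_eq _ (T.injective.iterate m), Set.inter_comm]

theorem integral_comp_measurePreserving {Z W : Type*} [MeasurableSpace Z] [MeasurableSpace W]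
    {S : Z → W} {μ : Measure Z} {ν : Measure W}
    (hS : MeasurePreserving S μ ν) {f : W → ℝ} (hf : Integrable f ν) :
    ∫ x, f (S x) ∂μ = ∫ x, f x ∂ν := by
  rw [← hS.map_eq, integral_map hS.aemeasurable]
  rw [hS.map_eq]
  exact hf.aestronglyMeasurable

/-- Indicators are the definition; the rest is density, since both sides are 1-Lipschitz in `f` for
the L¹ norm, uniformly in `m`. -/
theorem MixesSet.tendsto_setIntegral {Z : Type*} [MeasurableSpace Z] {Q : Z → Z} {lam : Measure Z}
    [IsProbabilityMeasure lam] (hQ : MeasurePreserving Q lam lam) {E : Set Z}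
    (h : MixesSet Q lam E) {f : Z → ℝ} (hf : Integrable f lam) :
    Tendsto (fun m : ℕ => ∫ z in E, f (Q^[m] z) ∂lam) atTop (𝓝 (lam.real E * ∫ z, f z ∂lam)) := by
  have hcomp : ∀ {g : Z → ℝ}, Integrable g lam → ∀ m, Integrable (fun z => g (Q^[m] z)) lam :=
    fun hg m => (hQ.iterate m).integrable_comp_of_integrable hg
  refine integrable_induction_of_approx (fun f : Z → ℝ => Tendsto
    (fun m : ℕ => ∫ z in E, f (Q^[m] z) ∂lam) atTop (𝓝 (lam.real E * ∫ z, f z ∂lam))) ?_ ?_ ?_ hf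
  · intro c s hs _
    have h1 := (h s hs).mul_const c
    rw [mul_assoc] at h1
    rw [integral_indicator_const _ hs, smul_eq_mul]
    refine h1.congr fun m => ?_
    have : (fun z => s.indicator (fun _ => c) (Q^[m] z)) = (Q^[m] ⁻¹' s).indicator fun _ => c := rfl
    have hms : MeasurableSet (Q^[m] ⁻¹' s) := (hQ.measurable.iterate m) hs
    rw [this, integral_indicator_const _ hms, smul_eq_mul, measureReal_restrict_apply hms,
      Set.inter_comm]
  · intro f g hf hg h1 h2
    have := h1.add h2
    simp only [Pi.add_apply]
    rw [integral_add hf hg, mul_add]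
    refine this.congr fun m => ?_
    rw [integral_add (hcomp hf m).integrableOn (hcomp hg m).integrableOn]
  · intro f hf happ
    rw [Metric.tendsto_atTop]
    intro ε hε
    obtain ⟨g, hg, hPg, hfg⟩ := happ (ε / 3) (by positivity)
    obtain ⟨N, hN⟩ := Metric.tendsto_atTop.1 hPg (ε / 3) (by positivity)
    refine ⟨N, fun m hm => ?_⟩
    have h1 := hN m hm
    rw [Real.dist_eq] at h1 ⊢
    have hd : Integrable (fun z => |f z - g z|) lam := (hf.sub hg).abs
    have h2 : |∫ z in E, f (Q^[m] z) ∂lam - ∫ z in E, g (Q^[m] z) ∂lam|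
        ≤ ∫ z, |f z - g z| ∂lam := by
      rw [← integral_sub (hcomp hf m).integrableOn (hcomp hg m).integrableOn]
      refine (abs_integral_le_integral_abs).trans ?_
      refine (setIntegral_le_integral (hcomp hd m) (ae_of_all _ fun _ => abs_nonneg _)).trans ?_
      exact (integral_comp_measurePreserving (hQ.iterate m) hd).le
    have h3 : |lam.real E * ∫ z, f z ∂lam - lam.real E * ∫ z, g z ∂lam|
        ≤ ∫ z, |f z - g z| ∂lam := by
      rw [← mul_sub, abs_mul, ← integral_sub hf hg, abs_of_nonneg measureReal_nonneg]
      exact (mul_le_of_le_one_left (abs_nonneg _) measureReal_le_one).trans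
        abs_integral_le_integral_abs
    rw [abs_le] at h2 h3
    rw [abs_lt] at h1 ⊢
    constructor <;> linarith [h1.1, h1.2, h2.1, h2.2, h3.1, h3.2]

/-! ### The mean ergodic theorem for a mixing map -/

theorem integrable_birkhoffSum {Z : Type*} [MeasurableSpace Z] {S : Z → Z} {μ : Measure Z}
    (hS : MeasurePreserving S μ μ) {f : Z → ℝ} (hf : Integrable f μ) (m : ℕ) :
    Integrable (birkhoffSum S f m) μ := by
  have : birkhoffSum S f m = fun x => ∑ i ∈ Finset.range m, f (S^[i] x) := rfl
  rw [this]
  exact integrable_finsetSum _ fun i _ => (hS.iterate i).integrable_comp_of_integrable hf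

theorem integral_abs_birkhoffSum_le {Z : Type*} [MeasurableSpace Z] {S : Z → Z} {μ : Measure Z}
    (hS : MeasurePreserving S μ μ) {f : Z → ℝ} (hf : Integrable f μ) (m : ℕ) :
    ∫ x, |birkhoffSum S f m x| ∂μ ≤ m * ∫ x, |f x| ∂μ := by
  induction m with
  | zero => simp [birkhoffSum]
  | succ m ih =>
    have hm := integrable_birkhoffSum hS hf m
    have hfm : Integrable (fun x => f (S^[m] x)) μ :=
      (hS.iterate m).integrable_comp_of_integrable hf
    calc ∫ x, |birkhoffSum S f (m + 1) x| ∂μ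
        ≤ ∫ x, (|birkhoffSum S f m x| + |f (S^[m] x)|) ∂μ := by
          refine integral_mono (integrable_birkhoffSum hS hf _).abs (hm.abs.add hfm.abs) fun x => ?_
          simp only [birkhoffSum_succ]
          exact abs_add_le _ _
      _ = ∫ x, |birkhoffSum S f m x| ∂μ + ∫ x, |f x| ∂μ := by
          rw [integral_add hm.abs hfm.abs,
            integral_comp_measurePreserving (hS.iterate m) (f := fun x => |f x|) hf.abs]
      _ ≤ _ := by push_cast; linarith

/-- Splitting off the first term leaves the sum of length `m` at `S x`, with the same second moment;
the new square and cross terms add at most `1 + 2 ∑ |c i|`. -/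
theorem integral_sq_birkhoffSum_le {Z : Type*} [MeasurableSpace Z] {S : Z → Z} {μ : Measure Z}
    [IsProbabilityMeasure μ] (hS : MeasurePreserving S μ μ) {f : Z → ℝ} (hf : Measurable f)
    (hb : ∀ x, |f x| ≤ 1) (m : ℕ) :
    ∫ x, birkhoffSum S f m x ^ 2 ∂μ
      ≤ m * (1 + 2 * ∑ i ∈ Finset.range m, |∫ x, f x * f (S^[i + 1] x) ∂μ|) := by
  have hbs : ∀ m, Measurable (birkhoffSum S f m) := fun m =>
    Finset.measurable_sum (Finset.range m) fun i _ => hf.comp (hS.measurable.iterate i)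
  have hbb : ∀ m x, |birkhoffSum S f m x| ≤ m := fun m x => by
    refine (Finset.abs_sum_le_sum_abs _ _).trans ?_
    refine (Finset.sum_le_card_nsmul _ _ 1 fun i _ => hb _).trans ?_
    simp
  have hsq : ∀ m, Integrable (fun x => birkhoffSum S f m x ^ 2) μ := fun m => by
    refine Integrable.of_bound ((hbs m).pow_const 2).aestronglyMeasurable ((m : ℝ) ^ 2)
      (ae_of_all _ fun x => ?_)
    rw [Real.norm_eq_abs, abs_pow]
    exact pow_le_pow_left₀ (abs_nonneg _) (hbb m x) 2
  have hprod : ∀ i, Integrable (fun x => f x * f (S^[i] x)) μ := fun i => by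
    refine Integrable.of_bound (hf.mul (hf.comp (hS.measurable.iterate i))).aestronglyMeasurable 1
      (ae_of_all _ fun x => ?_)
    rw [Real.norm_eq_abs, abs_mul]
    exact mul_le_one₀ (hb _) (abs_nonneg _) (hb _)
  induction m with
  | zero => simp
  | succ m ih =>
    set c : ℕ → ℝ := fun i => ∫ x, f x * f (S^[i + 1] x) ∂μ with hc
    have hcross : Integrable (fun x => ∑ i ∈ Finset.range m, f x * f (S^[i + 1] x)) μ :=
      integrable_finsetSum _ fun i _ => hprod (i + 1)
    have hf2 : Integrable (fun x => f x ^ 2) μ := by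
      simpa [sq] using hprod 0
    have hsqS : Integrable (fun x => birkhoffSum S f m (S x) ^ 2) μ :=
      hS.integrable_comp_of_integrable (hsq m)
    have hexp : ∀ x, birkhoffSum S f (m + 1) x ^ 2 = f x ^ 2
        + 2 * (∑ i ∈ Finset.range m, f x * f (S^[i + 1] x)) + birkhoffSum S f m (S x) ^ 2 := by
      intro x
      rw [birkhoffSum_succ', ← Finset.mul_sum]
      simp only [birkhoffSum, Function.iterate_succ_apply]
      ring
    simp only [hexp]
    have hA : Integrable (fun x => f x ^ 2 + 2 * ∑ i ∈ Finset.range m, f x * f (S^[i + 1] x)) μ :=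
      hf2.add (hcross.const_mul 2)
    rw [integral_add hA hsqS, integral_add hf2 (hcross.const_mul 2),
      integral_const_mul, integral_finsetSum _ fun i _ => hprod (i + 1),
      integral_comp_measurePreserving hS (hsq m)]
    have h1 : ∫ x, f x ^ 2 ∂μ ≤ 1 := by
      have := integral_mono hf2 (integrable_const 1) fun x => by
        have := hb x
        rw [abs_le] at this
        nlinarith [this.1, this.2]
      simpa using this
    have h2 : ∑ i ∈ Finset.range m, c i ≤ ∑ i ∈ Finset.range m, |c i| :=
      Finset.sum_le_sum fun i _ => le_abs_self _
    rw [Finset.sum_range_succ]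
    have h3 : 0 ≤ |c m| := abs_nonneg _
    have h4 : 0 ≤ ∑ i ∈ Finset.range m, |c i| := Finset.sum_nonneg fun i _ => abs_nonneg _
    push_cast
    nlinarith [mul_nonneg (Nat.cast_nonneg (α := ℝ) m) h3]

/-- The mean ergodic theorem in `L¹`. -/
theorem tendsto_integral_abs_birkhoffSum_div {Z : Type*} [MeasurableSpace Z] {S : Z → Z}
    {μ : Measure Z} [IsProbabilityMeasure μ] (hS : MeasurePreserving S μ μ)
    (hmix : ∀ A, MeasurableSet A → MixesSet S μ A) {f : Z → ℝ} (hf : Integrable f μ) :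
    Tendsto (fun m : ℕ => (∫ x, |birkhoffSum S (fun y => f y - ∫ z, f z ∂μ) m x| ∂μ) / m)
      atTop (𝓝 0) := by
  have hcen : ∀ {f : Z → ℝ}, Integrable f μ → Integrable (fun y => f y - ∫ z, f z ∂μ) μ :=
    fun hf => hf.sub (integrable_const _)
  have hnn : ∀ (f : Z → ℝ) (m : ℕ),
      0 ≤ (∫ x, |birkhoffSum S (fun y => f y - ∫ z, f z ∂μ) m x| ∂μ) / m := fun f m =>
    div_nonneg (integral_nonneg fun _ => abs_nonneg _) (Nat.cast_nonneg m)
  refine integrable_induction_of_approx (fun f : Z → ℝ => Tendsto (fun m : ℕ =>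
    (∫ x, |birkhoffSum S (fun y => f y - ∫ z, f z ∂μ) m x| ∂μ) / m) atTop (𝓝 0)) ?_ ?_ ?_ hf
  · intro c A hA _
    set a := μ.real A with ha
    set φ : Z → ℝ := fun y => A.indicator (fun _ => 1) y - a with hφ
    have hφm : Measurable φ := (measurable_const.indicator hA).sub_const a
    have ha0 : 0 ≤ a := measureReal_nonneg
    have ha1 : a ≤ 1 := measureReal_le_one
    have hφb : ∀ x, |φ x| ≤ 1 := fun x => by
      rw [abs_le]
      by_cases hx : x ∈ A <;> simp only [hφ, hx, Set.indicator_of_mem, Set.indicator_of_notMem,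
        not_false_eq_true] <;> constructor <;> linarith
    have hφi : Integrable φ μ := Integrable.of_bound hφm.aestronglyMeasurable 1
      (ae_of_all _ fun x => by simpa using hφb x)
    have hφ0 : ∫ x, φ x ∂μ = 0 := by
      rw [integral_sub ((integrable_const _).indicator hA) (integrable_const _),
        integral_indicator_const _ hA]
      simp [ha]
    -- As `φ` is the indicator of `A` minus a constant and has mean zero, its autocorrelation is the
    -- integral of `φ ∘ S^[i+1]` over `A`.
    have hcorr : Tendsto (fun i : ℕ => |∫ x, φ x * φ (S^[i + 1] x) ∂μ|) atTop (𝓝 0) := by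
      have h1 := ((hmix A hA).tendsto_setIntegral hS hφi).comp (tendsto_add_atTop_nat 1)
      rw [hφ0, mul_zero] at h1
      rw [← abs_zero]
      refine (h1.congr fun i => ?_).abs
      have hint : Integrable (fun x => φ (S^[i + 1] x)) μ :=
        (hS.iterate (i + 1)).integrable_comp_of_integrable hφi
      have : ∀ x, φ x * φ (S^[i + 1] x)
          = A.indicator (fun x => φ (S^[i + 1] x)) x - a * φ (S^[i + 1] x) := fun x => by
        by_cases hx : x ∈ A <;> simp [hφ, hx, sub_mul]
      simp only [this, Function.comp_apply]
      rw [integral_sub (hint.indicator hA) (hint.const_mul a), integral_const_mul,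
        integral_comp_measurePreserving (hS.iterate (i + 1)) hφi, hφ0, integral_indicator hA]
      simp
    have hv : Tendsto (fun m : ℕ => (∫ x, birkhoffSum S φ m x ^ 2 ∂μ) / (m : ℝ) ^ 2)
        atTop (𝓝 0) := by
      have h1 := (tendsto_inv_atTop_nhds_zero_nat (𝕜 := ℝ)).add (hcorr.cesaro.const_mul 2)
      rw [mul_zero, add_zero] at h1
      refine tendsto_of_tendsto_of_tendsto_of_le_of_le' tendsto_const_nhds h1
        (Eventually.of_forall fun m => div_nonneg (integral_nonneg fun _ => sq_nonneg _)
          (sq_nonneg _)) ?_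
      filter_upwards [eventually_gt_atTop 0] with m hm
      have hm' : (0 : ℝ) < m := by exact_mod_cast hm
      rw [div_le_iff₀ (by positivity)]
      refine (integral_sq_birkhoffSum_le hS hφm hφb m).trans (le_of_eq ?_)
      field_simp
    have hφt : Tendsto (fun m : ℕ => (∫ x, |birkhoffSum S φ m x| ∂μ) / m) atTop (𝓝 0) := by
      rw [Metric.tendsto_atTop]
      intro ε hε
      obtain ⟨N, hN⟩ := Metric.tendsto_atTop.1 hv (ε ^ 2) (by positivity)
      refine ⟨N + 1, fun m hm => ?_⟩
      have hm' : (0 : ℝ) < m := by exact_mod_cast (by omega : 0 < m)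
      have h1 := hN m (by omega)
      rw [Real.dist_eq, sub_zero] at h1 ⊢
      have h1' := (le_abs_self _).trans_lt h1
      rw [div_lt_iff₀ (by positivity)] at h1'
      rw [abs_of_nonneg (div_nonneg (integral_nonneg fun _ => abs_nonneg _) hm'.le),
        div_lt_iff₀ hm']
      have hi := integrable_birkhoffSum hS hφi m
      have hbb : ∀ x, |birkhoffSum S φ m x| ≤ m := fun x => by
        refine (Finset.abs_sum_le_sum_abs _ _).trans ?_
        refine (Finset.sum_le_card_nsmul _ _ 1 fun i _ => hφb _).trans ?_
        simp
      have hsq : Integrable (fun x => birkhoffSum S φ m x ^ 2) μ := by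
        refine Integrable.of_bound (hi.aestronglyMeasurable.pow 2) ((m : ℝ) ^ 2)
          (ae_of_all _ fun x => ?_)
        rw [Real.norm_eq_abs, abs_pow]
        exact pow_le_pow_left₀ (abs_nonneg _) (hbb x) 2
      -- From L² to L¹ by `|b| ≤ t/2 + b²/(2t)` with `t = ε m`.
      have h2 : ∫ x, |birkhoffSum S φ m x| ∂μ
          ≤ ∫ x, (ε * m / 2 + (2 * (ε * m))⁻¹ * birkhoffSum S φ m x ^ 2) ∂μ := by
        refine integral_mono hi.abs ((integrable_const _).add (hsq.const_mul _)) fun x => ?_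
        have hpos : 0 < ε * m := by positivity
        rw [← sq_abs (birkhoffSum S φ m x)]
        have h3 : ε * m / 2 + (2 * (ε * m))⁻¹ * |birkhoffSum S φ m x| ^ 2 - |birkhoffSum S φ m x|
            = (2 * (ε * m))⁻¹ * (|birkhoffSum S φ m x| - ε * m) ^ 2 := by
          field_simp
          ring
        have h4 : 0 ≤ (2 * (ε * m))⁻¹ * (|birkhoffSum S φ m x| - ε * m) ^ 2 := by positivity
        linarith
      refine h2.trans_lt ?_
      rw [integral_add (integrable_const _) (hsq.const_mul _), integral_const_mul,
        integral_const, probReal_univ, one_smul]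
      have h5 : (2 * (ε * m))⁻¹ * ∫ x, birkhoffSum S φ m x ^ 2 ∂μ
          < (2 * (ε * m))⁻¹ * (ε ^ 2 * m ^ 2) := mul_lt_mul_of_pos_left h1' (by positivity)
      have h6 : (2 * (ε * m))⁻¹ * (ε ^ 2 * m ^ 2) = ε * m / 2 := by
        field_simp
      linarith
    have := hφt.const_mul |c|
    rw [mul_zero] at this
    refine this.congr fun m => ?_
    have h7 : (fun y => A.indicator (fun _ => c) y - ∫ z, A.indicator (fun _ => c) z ∂μ)
        = fun y => c * φ y := by
      funext y
      rw [integral_indicator_const _ hA]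
      by_cases hy : y ∈ A <;> simp [hφ, hy, ha] <;> ring
    have h8 : ∀ x, birkhoffSum S (fun y => c * φ y) m x = c * birkhoffSum S φ m x := fun x => by
      simp only [birkhoffSum, Finset.mul_sum]
    rw [h7]
    simp only [h8, abs_mul]
    rw [integral_const_mul, mul_div_assoc]
  · intro f g hf hg h1 h2
    have h3 := h1.add h2
    rw [add_zero] at h3
    refine squeeze_zero (hnn _) (fun m => ?_) h3
    rw [← add_div]
    refine div_le_div_of_nonneg_right ?_ (Nat.cast_nonneg m)
    have hif := integrable_birkhoffSum hS (hcen hf) m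
    have hig := integrable_birkhoffSum hS (hcen hg) m
    rw [← integral_add hif.abs hig.abs]
    refine integral_mono (integrable_birkhoffSum hS (hcen (hf.add hg)) m).abs (hif.abs.add hig.abs)
      fun x => ?_
    refine le_trans (le_of_eq ?_) (abs_add_le _ _)
    simp only [birkhoffSum, ← Finset.sum_add_distrib, Pi.add_apply]
    rw [integral_add hf hg]
    congr 1
    exact Finset.sum_congr rfl fun i _ => by ring
  · intro f hf happ
    rw [Metric.tendsto_atTop]
    intro ε hε
    -- A quarter, because centring can double the L¹ distance between `f` and `g`.
    obtain ⟨g, hg, hPg, hfg⟩ := happ (ε / 4) (by positivity)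
    obtain ⟨N, hN⟩ := Metric.tendsto_atTop.1 hPg (ε / 4) (by positivity)
    refine ⟨N + 1, fun m hm => ?_⟩
    have hm' : (0 : ℝ) < m := by exact_mod_cast (by omega : 0 < m)
    have h1 := hN m (by omega)
    rw [Real.dist_eq, sub_zero, abs_of_nonneg (hnn _ _), div_lt_iff₀ hm'] at h1 ⊢
    have hd : Integrable (fun y => (f y - ∫ z, f z ∂μ) - (g y - ∫ z, g z ∂μ)) μ :=
      (hcen hf).sub (hcen hg)
    have h2 := integral_abs_birkhoffSum_le hS hd m
    have h3 : ∫ x, |(f x - ∫ z, f z ∂μ) - (g x - ∫ z, g z ∂μ)| ∂μ ≤ ε / 2 := by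
      have hfg' : Integrable (fun x => |f x - g x|) μ := (hf.sub hg).abs
      have h4 : |∫ z, f z ∂μ - ∫ z, g z ∂μ| ≤ ∫ z, |f z - g z| ∂μ := by
        rw [← integral_sub hf hg]
        exact abs_integral_le_integral_abs
      have h5 := integral_mono hd.abs (hfg'.add (integrable_const |∫ z, f z ∂μ - ∫ z, g z ∂μ|))
        fun x => by
          have : (f x - ∫ z, f z ∂μ) - (g x - ∫ z, g z ∂μ)
            = (f x - g x) - (∫ z, f z ∂μ - ∫ z, g z ∂μ) := by ring
          rw [this]
          exact abs_sub _ _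
      simp only [Pi.add_apply] at h5
      rw [integral_add hfg' (integrable_const _), integral_const, probReal_univ, one_smul] at h5
      linarith
    have h6 : ∫ x, |birkhoffSum S (fun y => f y - ∫ z, f z ∂μ) m x| ∂μ
        ≤ ∫ x, |birkhoffSum S (fun y => g y - ∫ z, g z ∂μ) m x| ∂μ
          + ∫ x, |birkhoffSum S (fun y => (f y - ∫ z, f z ∂μ) - (g y - ∫ z, g z ∂μ)) m x| ∂μ := by
      have hig := integrable_birkhoffSum hS (hcen hg) m
      have hid := integrable_birkhoffSum hS hd m
      rw [← integral_add hig.abs hid.abs]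
      refine integral_mono (integrable_birkhoffSum hS (hcen hf) m).abs (hig.abs.add hid.abs)
        fun x => ?_
      refine le_trans (le_of_eq ?_) (abs_add_le _ _)
      simp only [birkhoffSum, ← Finset.sum_add_distrib, add_sub_cancel]
    nlinarith

/-! ### Atkinson's theorem: recurrence of integer cocycles of mean zero -/

/-- The extension of `S` by the integer cocycle `n`. -/
def cocycleExtension {X : Type*} (S : X → X) (n : X → ℤ) : X × ℤ → X × ℤ :=
  fun p => (S p.1, p.2 + n p.1)

theorem cocycleExtension_iterate {X : Type*} (S : X → X) (n : X → ℤ) (m : ℕ) (p : X × ℤ) :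
    (cocycleExtension S n)^[m] p = (S^[m] p.1, p.2 + birkhoffSum S n m p.1) := by
  induction m generalizing p with
  | zero => simp
  | succ m ih =>
    rw [Function.iterate_succ_apply, ih, birkhoffSum_succ']
    simp [cocycleExtension, add_assoc]

/-- Two visits to `W` with equal Birkhoff sums would be a return with zero sum. So at most `2L + 1`
visits have sums in `[-L, L]`, and each other visit is paid for by a term `|sum| / L ≥ 1`. -/
theorem card_visits_le {X : Type*} (S : X → X) (n : X → ℤ) (W : Set X)
    (hW : ∀ x ∈ W, ∀ m : ℕ, m ≠ 0 → S^[m] x ∈ W → birkhoffSum S n m x ≠ 0)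
    (m L : ℕ) (hL : 0 < L) (x : X) :
    ∑ i ∈ Finset.range m, W.indicator (fun _ => (1 : ℝ)) (S^[i] x)
      ≤ 2 * L + 1 + (∑ i ∈ Finset.range m, |((birkhoffSum S n i x : ℤ) : ℝ)|) / L := by
  classical
  have hL' : (0 : ℝ) < L := by exact_mod_cast hL
  set A := (Finset.range m).filter fun i => S^[i] x ∈ W ∧ |birkhoffSum S n i x| ≤ L with hA
  have hcard : (A.card : ℝ) ≤ 2 * L + 1 := by
    have h1 : A.card ≤ (Finset.Icc (-(L : ℤ)) L).card := by
      refine Finset.card_le_card_of_injOn (fun i => birkhoffSum S n i x) (fun i hi => ?_) ?_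
      · rw [hA, Finset.mem_coe, Finset.mem_filter] at hi
        simpa [abs_le] using hi.2.2
      · have key : ∀ i ∈ A, ∀ j ∈ A, i < j → birkhoffSum S n i x ≠ birkhoffSum S n j x := by
          intro i hi j hj hij h
          rw [hA, Finset.mem_filter] at hi hj
          obtain ⟨d, rfl⟩ := Nat.exists_eq_add_of_lt hij
          have h2 := hW _ hi.2.1 (d + 1) (by omega) (by
            rw [← Function.iterate_add_apply]
            convert hj.2.1 using 2
            omega)
          rw [add_assoc, birkhoffSum_add] at h
          exact h2 (by omega)
        intro i hi j hj h
        rcases lt_trichotomy i j with hij | hij | hij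
        · exact absurd h (key i hi j hj hij)
        · exact hij
        · exact absurd h.symm (key j hj i hi hij)
    rw [Int.card_Icc] at h1
    have h2 : A.card ≤ 2 * L + 1 := by omega
    exact_mod_cast h2
  have hterm : ∀ i ∈ Finset.range m, W.indicator (fun _ => (1 : ℝ)) (S^[i] x)
      ≤ (if i ∈ A then 1 else 0) + |((birkhoffSum S n i x : ℤ) : ℝ)| / L := by
    intro i hi
    have h0 : 0 ≤ |((birkhoffSum S n i x : ℤ) : ℝ)| / L := by positivity
    by_cases hx : S^[i] x ∈ W
    · rw [Set.indicator_of_mem hx]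
      by_cases hs : |birkhoffSum S n i x| ≤ L
      · have : i ∈ A := by rw [hA, Finset.mem_filter]; exact ⟨hi, hx, hs⟩
        simpa [this] using h0
      · have h1 : (L : ℝ) ≤ |((birkhoffSum S n i x : ℤ) : ℝ)| := by
          have : (L : ℤ) ≤ |birkhoffSum S n i x| := by omega
          exact_mod_cast this
        have h2 : 1 ≤ |((birkhoffSum S n i x : ℤ) : ℝ)| / L := by
          rwa [le_div_iff₀ hL', one_mul]
        split_ifs <;> linarith
    · rw [Set.indicator_of_notMem hx]
      split_ifs <;> linarith
  refine (Finset.sum_le_sum hterm).trans ?_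
  rw [Finset.sum_add_distrib, ← Finset.sum_div]
  refine add_le_add_left (le_trans (le_of_eq ?_) hcard) _
  rw [← Finset.sum_filter, Finset.sum_const, nsmul_eq_mul, mul_one]
  congr 2
  ext i
  simp only [Finset.mem_filter, hA]
  tauto

/-- Integrate the visit count: a set of positive measure is visited linearly often on average,
whereas Birkhoff sums of size `o(m)` offer too few levels. -/
theorem measureReal_eq_zero_of_wandering {X : Type*} [MeasurableSpace X] {S : X → X}
    {μ : Measure X} [IsProbabilityMeasure μ] (hS : MeasurePreserving S μ μ) {n : X → ℤ}
    (hint : Integrable (fun x => (n x : ℝ)) μ)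
    (hlim : Tendsto (fun m : ℕ => (∫ x, |((birkhoffSum S n m x : ℤ) : ℝ)| ∂μ) / m) atTop (𝓝 0))
    {W : Set X} (hWm : MeasurableSet W)
    (hW : ∀ x ∈ W, ∀ m : ℕ, m ≠ 0 → S^[m] x ∈ W → birkhoffSum S n m x ≠ 0) :
    μ.real W = 0 := by
  have hcast : ∀ i x, ((birkhoffSum S n i x : ℤ) : ℝ) = birkhoffSum S (fun x => (n x : ℝ)) i x :=
    fun i x => by simp [birkhoffSum]
  have hbi : ∀ i, Integrable (fun x => |((birkhoffSum S n i x : ℤ) : ℝ)|) μ := fun i => by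
    simp only [hcast]
    exact (integrable_birkhoffSum hS hint i).abs
  have hWi : Integrable (W.indicator fun _ => (1 : ℝ)) μ := (integrable_const _).indicator hWm
  have hWS : ∀ i, Integrable (fun x => W.indicator (fun _ => (1 : ℝ)) (S^[i] x)) μ :=
    fun i => (hS.iterate i).integrable_comp_of_integrable hWi
  set e : ℕ → ℝ := fun i => ∫ x, |((birkhoffSum S n i x : ℤ) : ℝ)| ∂μ with he
  have he0 : ∀ i, 0 ≤ e i := fun i => integral_nonneg fun _ => abs_nonneg _
  have hbound : ∀ m L : ℕ, 0 < L →
      m * μ.real W ≤ 2 * L + 1 + (∑ i ∈ Finset.range m, e i) / L := by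
    intro m L hL
    have hl : Integrable
        (fun x => ∑ i ∈ Finset.range m, W.indicator (fun _ => (1 : ℝ)) (S^[i] x)) μ :=
      integrable_finsetSum _ fun i _ => hWS i
    have hr : Integrable
        (fun x => (∑ i ∈ Finset.range m, |((birkhoffSum S n i x : ℤ) : ℝ)|) / L) μ :=
      (integrable_finsetSum _ fun i _ => hbi i).div_const _
    have h1 := integral_mono hl ((integrable_const (2 * (L : ℝ) + 1)).add hr)
      fun x => card_visits_le S n W hW m L hL x
    simp only [Pi.add_apply] at h1
    rw [integral_add (integrable_const _) hr, integral_div, integral_finsetSum _ fun i _ => hbi i,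
      integral_finsetSum _ fun i _ => hWS i,
      integral_const, probReal_univ, one_smul] at h1
    refine le_trans (le_of_eq ?_) h1
    have : ∀ i, ∫ x, W.indicator (fun _ => (1 : ℝ)) (S^[i] x) ∂μ = μ.real W := fun i => by
      rw [integral_comp_measurePreserving (hS.iterate i) hWi, integral_indicator_const _ hWm]
      simp
    simp [this]
  -- Take `m = (q+1)L` and let `L → ∞`: `2L/m` gives the constant, and the remaining terms vanish by
  -- Cesàro averaging of `e i / i`.
  have hq : ∀ q : ℕ, μ.real W ≤ 2 / ((q : ℝ) + 1) := by
    intro q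
    have hq0 : (0 : ℝ) < (q : ℝ) + 1 := by positivity
    have hsub : Tendsto (fun L : ℕ => (q + 1) * L) atTop atTop :=
      tendsto_id.const_mul_atTop' (Nat.succ_pos q)
    have h1 := (hlim.cesaro.comp hsub).const_mul ((q : ℝ) + 1)
    have h2 := ((tendsto_inv_atTop_nhds_zero_nat (𝕜 := ℝ)).comp hsub).add h1
    have h3 := h2.const_add (2 / ((q : ℝ) + 1))
    rw [mul_zero, add_zero, add_zero] at h3
    refine ge_of_tendsto h3 ?_
    filter_upwards [eventually_gt_atTop 0] with L hL
    have hL' : (0 : ℝ) < L := by exact_mod_cast hL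
    have h4 := hbound ((q + 1) * L) L hL
    set M : ℕ := (q + 1) * L with hM
    have hMr : (M : ℝ) = ((q : ℝ) + 1) * L := by rw [hM]; push_cast; ring
    have hM0 : (0 : ℝ) < M := by rw [hMr]; positivity
    have h5 : (∑ i ∈ Finset.range M, e i) ≤ M * ∑ i ∈ Finset.range M, e i / i := by
      rw [Finset.mul_sum]
      refine Finset.sum_le_sum fun i hi => ?_
      rcases Nat.eq_zero_or_pos i with rfl | hi0
      · simp [he]
      · have hi' : (0 : ℝ) < i := by exact_mod_cast hi0
        have hiM : (i : ℝ) ≤ M := by exact_mod_cast (Finset.mem_range.1 hi).le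
        rw [mul_div_assoc', le_div_iff₀ hi', mul_comm]
        exact mul_le_mul_of_nonneg_right hiM (he0 i)
    simp only [Function.comp_apply]
    set s := ∑ i ∈ Finset.range M, e i / i with hs
    have h6 : M * μ.real W ≤ 2 * L + 1 + M * s / L :=
      h4.trans (by gcongr)
    have h7 : (M : ℝ) * (2 / ((q : ℝ) + 1) + ((M : ℝ)⁻¹ + ((q : ℝ) + 1) * ((M : ℝ)⁻¹ * s)))
        = 2 * L + 1 + M * s / L := by
      rw [hMr]
      field_simp
      ring
    rw [← h7] at h6
    exact le_of_mul_le_mul_left h6 hM0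
  have hlim0 : Tendsto (fun q : ℕ => 2 / ((q : ℝ) + 1)) atTop (𝓝 0) :=
    tendsto_const_nhds.div_atTop (tendsto_natCast_atTop_atTop.atTop_add tendsto_const_nhds)
  exact le_antisymm (ge_of_tendsto' hlim0 hq) measureReal_nonneg

/-- Atkinson's theorem for integer cocycles over a mixing transformation: the extension by a
cocycle of mean zero is conservative. -/
theorem conservative_cocycleExtension {X : Type*} [MeasurableSpace X] {S : X → X}
    {μ : Measure X} [IsProbabilityMeasure μ] (hS : MeasurePreserving S μ μ)
    (hmix : ∀ A, MeasurableSet A → MixesSet S μ A) {n : X → ℤ} (hn : Measurable n)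
    (hint : Integrable (fun x => (n x : ℝ)) μ) (hzero : ∫ x, (n x : ℝ) ∂μ = 0) :
    Conservative (cocycleExtension S n) (μ.prod Measure.count) := by
  have hmp : MeasurePreserving (cocycleExtension S n) (μ.prod Measure.count)
      (μ.prod Measure.count) := by
    refine hS.skew_product (g := fun x j => j + n x) ?_ (ae_of_all _ fun x => ?_)
    · exact measurable_snd.add (hn.comp measurable_fst)
    · exact map_add_right_eq_self _ _
  refine ⟨hmp.quasiMeasurePreserving, fun s hs h0 => ?_⟩
  -- Without returns to `s`, each slice at a level `j` is wandering in the above sense, hence null.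
  by_contra! hcon
  apply h0
  have hlim := tendsto_integral_abs_birkhoffSum_div hS hmix hint
  simp only [hzero, sub_zero] at hlim
  have hslice : ∀ j : ℤ, μ ((fun x => (x, j)) ⁻¹' s) = 0 := by
    intro j
    refine (measureReal_eq_zero_iff).1 (measureReal_eq_zero_of_wandering hS hint ?_
      (measurable_prodMk_right hs) fun x hx m hm hxm hb => ?_)
    · simpa [birkhoffSum] using hlim
    · refine hcon (x, j) hx m hm ?_
      rw [cocycleExtension_iterate]
      simpa [hb] using hxm
  rw [Measure.prod_apply_symm hs]
  simp [hslice]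

/-- Poincaré recurrence of the extension, applied to `A × {0}`. -/
theorem ae_frequently_return {X : Type*} [MeasurableSpace X] {S : X → X}
    {μ : Measure X} {n : X → ℤ}
    (hcons : Conservative (cocycleExtension S n) (μ.prod Measure.count))
    {A : Set X} (hA : MeasurableSet A) :
    ∀ᵐ x ∂μ, x ∈ A → ∃ᶠ m in atTop, S^[m] x ∈ A ∧ birkhoffSum S n m x = 0 := by
  have h1 := hcons.ae_mem_imp_frequently_image_mem
    (hA.prod (measurableSet_singleton (0 : ℤ))).nullMeasurableSet
  have h2 := Measure.ae_ae_of_ae_prod h1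
  filter_upwards [h2] with x hx hxA
  rw [Measure.ae_count_iff] at hx
  simpa [cocycleExtension_iterate, hxA] using hx 0

/-! ### Rigidity against mixing -/

/-- The integrals of `f ∘ Q^m` over `E` tend to the product by mixing, yet come back near the
integral of `f` over `E` for arbitrarily large `m`. -/
theorem setIntegral_eq_of_rigid {Z : Type*} [MeasurableSpace Z] {Q : Z → Z} {lam : Measure Z}
    [IsProbabilityMeasure lam] (hQ : MeasurePreserving Q lam lam) {E : Set Z}
    (h : MixesSet Q lam E) {f : Z → ℝ} (hf : Integrable f lam)
    (hrig : ∀ ε > 0, ∃ᶠ m in atTop, ∫ z, |f z - f (Q^[m] z)| ∂lam < ε) :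
    ∫ z in E, f z ∂lam = lam.real E * ∫ z, f z ∂lam := by
  rw [← sub_eq_zero, ← abs_eq_zero]
  refine le_antisymm (le_of_forall_pos_le_add fun ε hε => ?_) (abs_nonneg _)
  obtain ⟨N, hN⟩ := Metric.tendsto_atTop.1 (h.tendsto_setIntegral hQ hf) (ε / 2) (by positivity)
  obtain ⟨m, hm, hmN⟩ :=
    ((hrig (ε / 2) (by positivity)).and_eventually (eventually_ge_atTop N)).exists
  have h1 := hN m hmN
  rw [Real.dist_eq] at h1
  have hfm : Integrable (fun z => f (Q^[m] z)) lam :=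
    (hQ.iterate m).integrable_comp_of_integrable hf
  have h2 : |∫ z in E, f z ∂lam - ∫ z in E, f (Q^[m] z) ∂lam|
      ≤ ∫ z, |f z - f (Q^[m] z)| ∂lam := by
    rw [← integral_sub hf.integrableOn hfm.integrableOn]
    exact abs_integral_le_integral_abs.trans
      (setIntegral_le_integral (hf.sub hfm).abs (ae_of_all _ fun _ => abs_nonneg _))
  have h3 := abs_sub_le (∫ z in E, f z ∂lam) (∫ z in E, f (Q^[m] z) ∂lam)
    (lam.real E * ∫ z, f z ∂lam)
  linarith

/-- A function on `X × Z` invariant along the return times of a conservative cocycle on `X` has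
sections that are asymptotically rigid, hence uncorrelated with the mixing sets of `Q`. -/
theorem ae_setIntegral_eq_of_invariant {X Z : Type*} [MeasurableSpace X] [MeasurableSpace Z]
    [MeasurableSpace.CountablyGenerated Z] {S : X → X} {μ : Measure X} [IsProbabilityMeasure μ]
    {n : X → ℤ} (hcons : Conservative (cocycleExtension S n) (μ.prod Measure.count))
    {Q : Z → Z} {lam : Measure Z} [IsProbabilityMeasure lam] (hQ : MeasurePreserving Q lam lam)
    {E : Set Z} (h : MixesSet Q lam E) {F : X × Z → ℝ} (hFm : Measurable F)
    (hFi : Integrable F (μ.prod lam))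
    (hinv : ∀ m : ℕ, ∀ᵐ p ∂(μ.prod lam), birkhoffSum S n m p.1 = 0 →
      F (S^[m] p.1, Q^[m] p.2) = F p) :
    ∀ᵐ x ∂μ, ∫ z in E, F (x, z) ∂lam = lam.real E * ∫ z, F (x, z) ∂lam := by
  have : Fact ((1 : ENNReal) ≠ ⊤) := ⟨ENNReal.one_ne_top⟩
  obtain ⟨g, hgd⟩ := TopologicalSpace.exists_dense_seq (Lp ℝ 1 lam)
  have hgi : ∀ j, Integrable (g j) lam := fun j => L1.integrable_coeFn (g j)
  -- L¹ is separable, so for each radius countably many balls cover all sections; recurrence can be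
  -- imposed on all of them outside one null set.
  set A : ℕ → ℕ → Set X := fun j q => {x | ∫ z, |F (x, z) - g j z| ∂lam < 1 / ((q : ℝ) + 1)}
    with hA
  have hAm : ∀ j q, MeasurableSet (A j q) := by
    intro j q
    have hm : Measurable fun p : X × Z => |F p - g j p.2| := by
      have := (Lp.stronglyMeasurable (g j)).measurable
      exact (hFm.sub (this.comp measurable_snd)).abs
    exact measurableSet_lt (hm.stronglyMeasurable.integral_prod_right' (ν := lam)).measurable
      measurable_const
  have hret : ∀ᵐ x ∂μ, ∀ j q, x ∈ A j q →
      ∃ᶠ m in atTop, S^[m] x ∈ A j q ∧ birkhoffSum S n m x = 0 := by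
    rw [ae_all_iff]; intro j
    rw [ae_all_iff]; intro q
    exact ae_frequently_return hcons (hAm j q)
  have hinv' : ∀ᵐ x ∂μ, ∀ m : ℕ, ∀ᵐ z ∂lam, birkhoffSum S n m x = 0 →
      F (S^[m] x, Q^[m] z) = F (x, z) := by
    rw [ae_all_iff]; intro m
    exact Measure.ae_ae_of_ae_prod (hinv m)
  filter_upwards [hret, hinv', hFi.prod_right_ae] with x hx1 hx2 hx3
  refine setIntegral_eq_of_rigid hQ h hx3 fun ε hε => ?_
  obtain ⟨q, hq⟩ := exists_nat_one_div_lt (half_pos hε)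
  obtain ⟨j, hj⟩ : ∃ j, x ∈ A j q := by
    obtain ⟨j, hj⟩ := Metric.denseRange_iff.1 hgd (hx3.toL1 _) (1 / ((q : ℝ) + 1)) (by positivity)
    refine ⟨j, ?_⟩
    rw [dist_eq_norm, L1.norm_eq_integral_norm] at hj
    refine lt_of_eq_of_lt (integral_congr_ae ?_) hj
    filter_upwards [Lp.coeFn_sub (hx3.toL1 _) (g j), hx3.coeFn_toL1] with z hz1 hz2
    rw [hz1, Pi.sub_apply, hz2, Real.norm_eq_abs]
  -- At such a return `F(x, z) = F(S^m x, Q^m z)`, and the sections at `x` and `S^m x` are both near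
  -- `g j`; compare both with `g j ∘ Q^m`.
  refine (hx1 j q hj).mono fun m hm => ?_
  have hQm := hQ.iterate m
  have hxm : Integrable (fun z => F (x, Q^[m] z)) lam := hQm.integrable_comp_of_integrable hx3
  have hgm : Integrable (fun z => g j (Q^[m] z)) lam := hQm.integrable_comp_of_integrable (hgi j)
  have h1 : ∫ z, |F (x, z) - g j (Q^[m] z)| ∂lam < ε / 2 := by
    have h2 : ∫ z, |F (x, z) - g j (Q^[m] z)| ∂lam = ∫ z, |F (S^[m] x, z) - g j z| ∂lam := by
      have hmeas : Measurable fun z => |F (S^[m] x, z) - g j z| :=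
        ((hFm.comp measurable_prodMk_left).sub (Lp.stronglyMeasurable (g j)).measurable).abs
      have h3 := integral_map hQm.aemeasurable (f := fun z => |F (S^[m] x, z) - g j z|)
        hmeas.aestronglyMeasurable
      rw [hQm.map_eq] at h3
      rw [h3]
      refine integral_congr_ae ?_
      filter_upwards [hx2 m] with z hz
      rw [hz hm.2]
    rw [h2]
    exact lt_trans hm.1 hq
  have h3 : ∫ z, |F (x, Q^[m] z) - g j (Q^[m] z)| ∂lam < ε / 2 := by
    rw [integral_comp_measurePreserving hQm (f := fun z => |F (x, z) - g j z|)
      (hx3.sub (hgi j)).abs]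
    exact lt_trans hj hq
  have h4 : ∫ z, |F (x, z) - F (x, Q^[m] z)| ∂lam
      ≤ ∫ z, (|F (x, z) - g j (Q^[m] z)| + |F (x, Q^[m] z) - g j (Q^[m] z)|) ∂lam := by
    refine integral_mono (hx3.sub hxm).abs ((hx3.sub hgm).abs.add (hxm.sub hgm).abs) fun z => ?_
    refine (abs_sub_le _ (g j (Q^[m] z)) _).trans (le_of_eq ?_)
    rw [abs_sub_comm (g j (Q^[m] z))]
  have h5 := integral_add (hx3.sub hgm).abs (hxm.sub hgm).abs
  simp only [Pi.sub_apply] at h5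
  rw [h5] at h4
  linarith

theorem skewProduct_iterate {X Y : Type*} [MeasurableSpace X] [MeasurableSpace Y]
    (S : X ≃ᵐ X) (T : Y ≃ᵐ Y) (n : X → ℤ) (hn : Measurable n) (m : ℕ) (p : X × Y) :
    (skewProduct S T n hn)^[m] p
      = (S^[m] p.1, (T.toEquiv ^ birkhoffSum S n m p.1 : Equiv.Perm Y) p.2) := by
  induction m generalizing p with
  | zero => simp
  | succ m ih =>
    have h1 : skewProduct S T n hn p = (S p.1, (T.toEquiv ^ n p.1 : Equiv.Perm Y) p.2) := rfl
    rw [Function.iterate_succ_apply, ih, h1, birkhoffSum_succ', add_comm (n p.1), zpow_add,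
      Equiv.Perm.mul_apply, Function.iterate_succ_apply]

/-- An invariant coupling of a skew product over a conservative cocycle with a system `Q` is the
product as soon as its projection that forgets the fibre is the product. -/
theorem measure_prod_prod_of_invariant {X Y Z : Type*} [MeasurableSpace X] [MeasurableSpace Y]
    [MeasurableSpace Z] [MeasurableSpace.CountablyGenerated Z]
    {μ : Measure X} [IsProbabilityMeasure μ] {μ' : Measure Y} [IsProbabilityMeasure μ']
    {lam : Measure Z} [IsProbabilityMeasure lam]
    {S : X ≃ᵐ X} (hS : MeasurePreserving S μ μ) {T : Y ≃ᵐ Y} {n : X → ℤ} {hn : Measurable n}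
    (hcons : Conservative (cocycleExtension S n) (μ.prod Measure.count))
    {Q : Z ≃ᵐ Z} (hQ : MeasurePreserving Q lam lam)
    {ρ : Measure ((X × Y) × Z)} [IsProbabilityMeasure ρ]
    (hρ : MeasurePreserving (Prod.map (skewProduct S T n hn) Q) ρ ρ)
    (hXZ : ρ.map (fun p => (p.1.1, p.2)) = μ.prod lam)
    (hXY : ∀ A B, MeasurableSet A → MeasurableSet B →
      ρ ((A ×ˢ B) ×ˢ Set.univ) = μ A * μ' B)
    {A : Set X} {B : Set Y} {E : Set Z} (hA : MeasurableSet A) (hB : MeasurableSet B)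
    (hE : MeasurableSet E) (hmix : MixesSet Q lam E) :
    ρ ((A ×ˢ B) ×ˢ E) = μ A * μ' B * lam E := by
  set π : (X × Y) × Z → X × Z := fun p => (p.1.1, p.2) with hπ
  have hπm : Measurable π := (measurable_fst.comp measurable_fst).prodMk measurable_snd
  set κ := μ.prod lam with hκ
  have hBm : MeasurableSet {p : (X × Y) × Z | p.1.2 ∈ B} :=
    (measurable_snd.comp measurable_fst) hB
  -- Since `ρ` projects to `κ`, the density of `σ` is the conditional probability of `y ∈ B` given
  -- `(x, z)`.
  set σ := (ρ.restrict {p : (X × Y) × Z | p.1.2 ∈ B}).map π with hσ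
  have hσapp : ∀ C, MeasurableSet C → σ C = ρ (π ⁻¹' C ∩ {p | p.1.2 ∈ B}) := fun C hC => by
    rw [hσ, Measure.map_apply hπm hC, Measure.restrict_apply (hπm hC)]
  have hσκ : σ ≪ κ := by
    rw [← hXZ]
    exact (Measure.absolutelyContinuous_of_le Measure.restrict_le_self).map hπm
  set f := σ.rnDeriv κ with hf
  have hfm : Measurable f := Measure.measurable_rnDeriv _ _
  have hfσ : ∀ C, MeasurableSet C → ∫⁻ p in C, f p ∂κ = σ C := fun C hC => by
    rw [← withDensity_apply _ hC, Measure.withDensity_rnDeriv_eq _ _ hσκ]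
  have hV : MeasurePreserving (S.prodCongr Q) κ κ := hS.prod hQ
  have hVi : ∀ m p, (S.prodCongr Q)^[m] p = (S^[m] p.1, Q^[m] p.2) := fun m p => by
    have : ⇑(S.prodCongr Q) = Prod.map S Q := rfl
    rw [this, Prod.map_iterate]
    rfl
  -- Where the cocycle sum vanishes the dynamics fix `y`, so invariance of `ρ` equates the
  -- `σ`-masses of a subset `C'` and of its forward image `C''`.
  have hinv : ∀ m : ℕ, ∀ᵐ p ∂κ, birkhoffSum S n m p.1 = 0 → f ((S.prodCongr Q)^[m] p) = f p := by
    intro m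
    have hbm : Measurable (birkhoffSum S n m) :=
      Finset.measurable_sum (Finset.range m) fun i _ => hn.comp (S.measurable.iterate i)
    have hD : MeasurableSet {p : X × Z | birkhoffSum S n m p.1 = 0} :=
      (hbm.comp measurable_fst) (measurableSet_singleton 0)
    have hVm := hV.iterate m
    refine (ae_restrict_iff' hD).1 ?_
    refine ae_eq_of_forall_setLIntegral_eq_of_sigmaFinite (hfm.comp hVm.measurable) hfm
      fun C hC _ => ?_
    rw [Measure.restrict_restrict hC]
    set C' := C ∩ {p : X × Z | birkhoffSum S n m p.1 = 0} with hC'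
    have hC'm : MeasurableSet C' := hC.inter hD
    set C'' := (S.prodCongr Q).symm^[m] ⁻¹' C' with hC''
    have hC''m : MeasurableSet C'' := ((S.prodCongr Q).symm.measurable.iterate m) hC'm
    have hpre : (S.prodCongr Q)^[m] ⁻¹' C'' = C' := by
      rw [hC'', ← image_iterate_eq_preimage,
        Set.preimage_image_eq _ ((S.prodCongr Q).injective.iterate m)]
    calc ∫⁻ p in C', f ((S.prodCongr Q)^[m] p) ∂κ
        = ∫⁻ p in (S.prodCongr Q)^[m] ⁻¹' C'', f ((S.prodCongr Q)^[m] p) ∂κ := by rw [hpre]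
      _ = ∫⁻ p in C'', f p ∂κ := hVm.setLIntegral_comp_preimage hC''m hfm
      _ = σ C'' := hfσ _ hC''m
      _ = ρ (π ⁻¹' C'' ∩ {p | p.1.2 ∈ B}) := hσapp _ hC''m
      _ = ρ (π ⁻¹' C' ∩ {p | p.1.2 ∈ B}) := by
          rw [← (hρ.iterate m).measure_preimage ((hπm hC''m).inter hBm).nullMeasurableSet]
          congr 1
          ext p
          have h1 : (Prod.map (skewProduct S T n hn) Q)^[m] p
              = ((S^[m] p.1.1, (T.toEquiv ^ birkhoffSum S n m p.1.1 : Equiv.Perm Y) p.1.2),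
                Q^[m] p.2) := by
            rw [Prod.map_iterate, Prod.map_apply, skewProduct_iterate]
          have h2 : (S^[m] p.1.1, Q^[m] p.2) ∈ C'' ↔ π p ∈ C' := by
            have : (S.prodCongr Q)^[m] (π p) = (S^[m] p.1.1, Q^[m] p.2) := hVi m (π p)
            rw [← this, ← Set.mem_preimage, hpre]
          simp only [Set.mem_preimage, Set.mem_inter_iff, Set.mem_ofPred_eq, h1]
          rw [show π ((S^[m] p.1.1, (T.toEquiv ^ birkhoffSum S n m p.1.1 : Equiv.Perm Y) p.1.2),
            Q^[m] p.2) = (S^[m] p.1.1, Q^[m] p.2) from rfl, h2]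
          refine and_congr_right fun h3 => ?_
          have h4 : birkhoffSum S n m p.1.1 = 0 := h3.2
          rw [h4]
          simp
      _ = σ C' := (hσapp _ hC'm).symm
      _ = ∫⁻ p in C', f p ∂κ := (hfσ _ hC'm).symm
  set F : X × Z → ℝ := fun p => (f p).toReal with hF
  have hFi : Integrable F κ := Measure.integrable_toReal_rnDeriv
  have hFσ : ∀ C, MeasurableSet C → ∫ p in C, F p ∂κ = σ.real C := fun C hC => by
    rw [hF, integral_toReal hfm.aemeasurable
      (ae_restrict_of_ae (Measure.rnDeriv_lt_top σ κ)), hfσ C hC, Measure.real]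
  have hsec := ae_setIntegral_eq_of_invariant hcons hQ hmix hfm.ennreal_toReal hFi
    fun m => by
      filter_upwards [hinv m] with p hp hp0
      rw [← hVi, hp hp0]
  have hprodint : ∀ C, MeasurableSet C →
      ∫ p in A ×ˢ C, F p ∂κ = ∫ x in A, ∫ z in C, F (x, z) ∂lam ∂μ := fun C hC => by
    rw [hκ, setIntegral_prod _ hFi.integrableOn]
  have h1 : σ.real (A ×ˢ E) = lam.real E * σ.real (A ×ˢ Set.univ) := by
    rw [← hFσ _ (hA.prod hE), ← hFσ _ (hA.prod MeasurableSet.univ), hprodint E hE,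
      hprodint _ MeasurableSet.univ, ← integral_const_mul]
    refine integral_congr_ae (ae_restrict_of_ae ?_)
    filter_upwards [hsec] with x hx
    rw [hx, Measure.restrict_univ]
  have h2 : σ (A ×ˢ E) = lam E * σ (A ×ˢ Set.univ) := by
    rw [← ENNReal.toReal_eq_toReal_iff' (by finiteness) (by finiteness), ENNReal.toReal_mul]
    exact h1
  have h3 : ∀ C, MeasurableSet C → σ (A ×ˢ C) = ρ ((A ×ˢ B) ×ˢ C) := fun C hC => by
    rw [hσapp _ (hA.prod hC)]
    congr 1
    ext p
    simp only [hπ, Set.mem_inter_iff, Set.mem_preimage, Set.mem_prod, Set.mem_ofPred_eq]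
    tauto
  rw [← h3 E hE, h2, h3 _ MeasurableSet.univ, hXY A B hA hB, mul_comm]

/-! ### Mixing of boxes in a power, and invariance of the skew product -/

/-- For disjoint unions limit and sum commute by dominated convergence: invariance bounds each term
by `lam.real (f i)`. -/
theorem MixesSet.of_piSystem {Z : Type*} [mZ : MeasurableSpace Z] {Q : Z → Z} {lam : Measure Z}
    [IsProbabilityMeasure lam] (hQ : MeasurePreserving Q lam lam) {E : Set Z}
    (hE : MeasurableSet E) {s : Set (Set Z)} (h_eq : mZ = MeasurableSpace.generateFrom s)
    (h_inter : IsPiSystem s)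
    (h : ∀ B ∈ s, Tendsto (fun m : ℕ => lam.real (E ∩ Q^[m] ⁻¹' B)) atTop
      (𝓝 (lam.real E * lam.real B))) : MixesSet Q lam E := by
  have hpre : ∀ {B : Set Z}, MeasurableSet B → ∀ m : ℕ, MeasurableSet (Q^[m] ⁻¹' B) :=
    fun hB m => (hQ.measurable.iterate m) hB
  intro B hB
  induction B, hB using MeasurableSpace.induction_on_inter h_eq h_inter with
  | empty => simp
  | basic t ht => exact h t ht
  | compl t htm ih =>
    rw [probReal_compl_eq_one_sub htm, mul_sub, mul_one]
    refine (ih.const_sub (lam.real E)).congr fun m => ?_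
    rw [Set.preimage_compl, ← Set.sdiff_eq, ← measureReal_sdiff_add_inter (s := E) (hpre htm m)]
    ring
  | iUnion f hd hfm ih =>
    have hsum : ∀ A : ℕ → Set Z, Pairwise (Function.onFun Disjoint A) →
        (∀ i, MeasurableSet (A i)) → HasSum (fun i => lam.real (A i)) (lam.real (⋃ i, A i)) := by
      intro A hA hAm
      have h0 := measure_iUnion (μ := lam) hA hAm
      have h1 := ENNReal.hasSum_toReal (f := fun i => lam (A i)) (by
        rw [← h0]
        exact measure_ne_top _ _)
      rw [Measure.real, h0, ENNReal.tsum_toReal_eq fun i => measure_ne_top _ _]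
      exact h1
    have h1 : lam.real E * lam.real (⋃ i, f i) = ∑' i, lam.real E * lam.real (f i) := by
      rw [tsum_mul_left, (hsum f hd hfm).tsum_eq]
    have h2 : ∀ m : ℕ, ∑' i, lam.real (E ∩ Q^[m] ⁻¹' f i)
        = lam.real (E ∩ Q^[m] ⁻¹' ⋃ i, f i) := by
      intro m
      rw [Set.preimage_iUnion, Set.inter_iUnion]
      exact (hsum _ (fun i j hij => ((hd hij).preimage _).mono Set.inter_subset_right
        Set.inter_subset_right) fun i => hE.inter (hpre (hfm i) m)).tsum_eq
    rw [h1]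
    refine (tendsto_tsum_of_dominated_convergence (bound := fun i => lam.real (f i)) ?_ ih
      (Eventually.of_forall fun m i => ?_)).congr h2
    · exact (hsum f hd hfm).summable
    · rw [Real.norm_eq_abs, abs_of_nonneg measureReal_nonneg,
        ← (hQ.iterate m).measureReal_preimage (hfm i).nullMeasurableSet]
      exact measureReal_mono Set.inter_subset_right

/-- The correlation of two boxes is the product of the coordinate correlations, and boxes form a
generating π-system. -/
theorem MixesSet.pi {W ι : Type*} [Fintype ι] [MeasurableSpace W] {R : W → W} {m : Measure W}
    [IsProbabilityMeasure m] (hR : MeasurePreserving R m m)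
    (h : ∀ A, MeasurableSet A → MixesSet R m A) {A : ι → Set W} (hA : ∀ i, MeasurableSet (A i)) :
    MixesSet (fun (z : ι → W) i => R (z i)) (Measure.pi fun _ => m) (Set.univ.pi A) := by
  have hit : ∀ (k : ℕ) (z : ι → W), (fun (z : ι → W) i => R (z i))^[k] z = fun i => R^[k] (z i) := by
    intro k
    induction k with
    | zero => intro z; rfl
    | succ k ih =>
      intro z
      rw [Function.iterate_succ_apply, ih]
      rfl
  refine MixesSet.of_piSystem (measurePreserving_pi _ _ fun _ => hR) (MeasurableSet.univ_pi hA)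
    generateFrom_pi.symm isPiSystem_pi ?_
  rintro _ ⟨B, hB, rfl⟩
  have hB' : ∀ i, MeasurableSet (B i) := fun i => hB i (Set.mem_univ i)
  have hreal : ∀ C : ι → Set W,
      (Measure.pi fun _ => m).real (Set.univ.pi C) = ∏ i, m.real (C i) := fun C => by
    rw [Measure.real, Measure.pi_pi, ENNReal.toReal_prod]
    rfl
  rw [hreal, hreal, ← Finset.prod_mul_distrib]
  refine (tendsto_finsetProd _ fun i _ => h (A i) (hA i) (B i) (hB' i)).congr fun k => ?_
  rw [← hreal]
  congr 1
  ext z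
  simp only [Set.mem_pi, Set.mem_univ, true_implies, Set.mem_inter_iff, Set.mem_preimage, hit,
    forall_and]

theorem MeasureTheory.MeasurePreserving.zpow_perm {Y : Type*} [MeasurableSpace Y] {μ' : Measure Y} {T : Y ≃ᵐ Y}
    (hT : MeasurePreserving T μ' μ') (k : ℤ) :
    MeasurePreserving (fun y => (T.toEquiv ^ k : Equiv.Perm Y) y) μ' μ' := by
  have hpow : ∀ k : ℕ, MeasurePreserving (fun y => (T.toEquiv ^ k : Equiv.Perm Y) y) μ' μ' := by
    intro k
    convert hT.iterate k using 1
    funext y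
    rw [← Equiv.Perm.iterate_eq_pow]
    rfl
  obtain ⟨k, rfl | rfl⟩ := k.eq_nat_or_neg
  · simpa using hpow k
  · refine ⟨measurable_zpow_perm T _, ?_⟩
    conv_lhs => rw [← (hpow k).map_eq]
    rw [Measure.map_map (measurable_zpow_perm T _) (hpow k).measurable]
    convert Measure.map_id
    funext y
    simp

theorem measurePreserving_skewProduct {X Y : Type*} [MeasurableSpace X] [MeasurableSpace Y]
    {μ : Measure X} [IsProbabilityMeasure μ] {μ' : Measure Y} [IsProbabilityMeasure μ']
    {S : X ≃ᵐ X} (hS : MeasurePreserving S μ μ) {T : Y ≃ᵐ Y} (hT : MeasurePreserving T μ' μ')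
    {n : X → ℤ} (hn : Measurable n) :
    MeasurePreserving (skewProduct S T n hn) (μ.prod μ') (μ.prod μ') :=
  hS.skew_product (g := fun x y => (T.toEquiv ^ n x : Equiv.Perm Y) y)
    (measurable_zpow_perm_prod T hn) (ae_of_all _ fun x => (hT.zpow_perm (n x)).map_eq)

/-! ### Independence of couplings, one fibre at a time -/

section Couplings

variable {X Y ι : Type*} [Fintype ι] [MeasurableSpace X] [MeasurableSpace Y]
  [StandardBorelSpace X] [StandardBorelSpace Y]
  {μ : Measure X} [IsProbabilityMeasure μ] {μ' : Measure Y} [IsProbabilityMeasure μ']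
  {S : X ≃ᵐ X} {T : Y ≃ᵐ Y} {n : X → ℤ} {hn : Measurable n}
  {ν : Measure (ι → X × Y)} [IsProbabilityMeasure ν]

/-- If the `i`-th fibre coordinate is forgotten and the rest of an invariant coupling is
independent, then the whole coupling is independent. -/
theorem eq_pi_of_forget_fibre [DecidableEq ι] (hS : MeasurePreserving S μ μ)
    (hT : MeasurePreserving T μ' μ')
    (hcons : Conservative (cocycleExtension S n) (μ.prod Measure.count))
    (hmix : ∀ A, MeasurableSet A → MixesSet (skewProduct S T n hn) (μ.prod μ') A)
    (hν : MeasurePreserving (fun (z : ι → X × Y) j => skewProduct S T n hn (z j)) ν ν) (i : ι)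
    (hi : MeasurePreserving (fun z : ι → X × Y => z i) ν (μ.prod μ'))
    (hrect : ∀ (A : Set X) (C : ι → Set (X × Y)), MeasurableSet A → (∀ j, MeasurableSet (C j)) →
      C i = A ×ˢ Set.univ → ν (Set.univ.pi C) = ∏ j, μ.prod μ' (C j)) :
    ν = Measure.pi fun _ => μ.prod μ' := by
  set R := skewProduct S T n hn with hR
  set m := μ.prod μ' with hm
  have hRm : MeasurePreserving R m m := measurePreserving_skewProduct hS hT hn
  set Q : (ι → X × Y) ≃ᵐ (ι → X × Y) := MeasurableEquiv.piCongrRight fun _ => R with hQ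
  have hQfun : ⇑Q = fun (z : ι → X × Y) j => R (z j) := rfl
  have hQm : MeasurePreserving Q (Measure.pi fun _ => m) (Measure.pi fun _ => m) :=
    measurePreserving_pi _ _ fun _ => hRm
  -- Extract the `i`-th point and put an independent one in its place: this couples `R` with the
  -- full power `Q` without changing the index type.
  set φ : (ι → X × Y) × (X × Y) → (X × Y) × (ι → X × Y) :=
    fun p => (p.1 i, Function.update p.1 i p.2) with hφ
  have hφm : Measurable φ :=
    ((measurable_pi_apply i).comp measurable_fst).prodMk measurable_update'
  set ρ := (ν.prod m).map φ with hρ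
  have : IsProbabilityMeasure ρ := Measure.isProbabilityMeasure_map hφm.aemeasurable
  have hρinv : MeasurePreserving (Prod.map R Q) ρ ρ := by
    refine (MeasurePreserving.of_semiconj (f := φ) ⟨hφm, rfl⟩ (hν.prod hRm) (fun p => ?_)
      (R.measurable.prodMap Q.measurable))
    refine Prod.ext rfl (funext fun j => ?_)
    by_cases hj : j = i
    · subst hj; simp [hφ, hQfun]
    · simp [hφ, hQfun, hj]
  have hmem : ∀ (C : ι → Set (X × Y)) (z : ι → X × Y) (w : X × Y) (D : Set (X × Y)),
      (z i ∈ D ∧ Function.update z i w ∈ Set.univ.pi C)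
        ↔ (z ∈ Set.univ.pi (Function.update C i D) ∧ w ∈ C i) := by
    intro C z w D
    simp only [Set.mem_pi, Set.mem_univ, true_implies]
    constructor
    · rintro ⟨h1, h2⟩
      refine ⟨fun j => ?_, by simpa using h2 i⟩
      by_cases hj : j = i
      · subst hj; simpa using h1
      · simpa [hj] using h2 j
    · rintro ⟨h1, h2⟩
      refine ⟨by simpa using h1 i, fun j => ?_⟩
      by_cases hj : j = i
      · subst hj; simpa using h2
      · simpa [hj] using h1 j
  have hρC : ∀ (C : ι → Set (X × Y)) (D : Set (X × Y)), (∀ j, MeasurableSet (C j)) →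
      MeasurableSet D →
      ρ (D ×ˢ Set.univ.pi C) = ν (Set.univ.pi (Function.update C i D)) * m (C i) := by
    intro C D hC hD
    rw [hρ, Measure.map_apply hφm (hD.prod (MeasurableSet.univ_pi hC)), ← Measure.prod_prod]
    congr 1
    ext ⟨z, w⟩
    exact hmem C z w D
  have hupd : ∀ (C : ι → Set (X × Y)) (D : Set (X × Y)),
      (∏ j, m (Function.update C i D j)) * m (C i) = m D * ∏ j, m (C j) := by
    intro C D
    have h1 : ∀ j, m (Function.update C i D j) = Function.update (fun j => m (C j)) i (m D) j :=
      fun j => Function.apply_update (fun _ => m) C i D j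
    simp only [h1]
    rw [Finset.prod_update_of_mem (Finset.mem_univ i), mul_assoc,
      Finset.prod_eq_prod_sdiff_singleton_mul (Finset.mem_univ i)]
  have hupdm : ∀ (C : ι → Set (X × Y)) (D : Set (X × Y)), (∀ j, MeasurableSet (C j)) →
      MeasurableSet D → ∀ j, MeasurableSet (Function.update C i D j) := by
    intro C D hC hD j
    by_cases hj : j = i
    · subst hj; simpa using hD
    · simpa [hj] using hC j
  have hXZ : ρ.map (fun p => (p.1.1, p.2)) = μ.prod (Measure.pi fun _ => m) := by
    symm
    refine Measure.prod_eq_generateFrom MeasurableSpace.generateFrom_measurableSet generateFrom_pi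
      MeasurableSpace.isPiSystem_measurableSet isPiSystem_pi μ.toFiniteSpanningSetsIn
      (Measure.FiniteSpanningSetsIn.pi fun _ => m.toFiniteSpanningSetsIn) ?_
    rintro A hA _ ⟨C, hC, rfl⟩
    have hA' : MeasurableSet A := hA
    have hC' : ∀ j, MeasurableSet (C j) := fun j => hC j (Set.mem_univ j)
    have hAu : MeasurableSet (A ×ˢ (Set.univ : Set Y)) := hA'.prod MeasurableSet.univ
    rw [Measure.map_apply (by fun_prop) (hA'.prod (MeasurableSet.univ_pi hC')), Measure.pi_pi]
    have h1 : (fun p : (X × Y) × (ι → X × Y) => (p.1.1, p.2)) ⁻¹' (A ×ˢ Set.univ.pi C)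
        = (A ×ˢ Set.univ) ×ˢ Set.univ.pi C := by
      ext p; simp
    rw [h1, hρC C _ hC' hAu, hrect A _ hA' (hupdm C _ hC' hAu) (by simp), hupd, hm,
      Measure.prod_prod]
    simp
  have hXY : ∀ D, MeasurableSet D → ρ (D ×ˢ Set.univ) = m D := by
    intro D hD
    rw [hρ, Measure.map_apply hφm (hD.prod MeasurableSet.univ), ← hi.measure_preimage
      hD.nullMeasurableSet]
    have h1 : φ ⁻¹' (D ×ˢ Set.univ) = ((fun z : ι → X × Y => z i) ⁻¹' D) ×ˢ Set.univ := by
      ext p; simp [hφ]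
    rw [h1, Measure.prod_prod, measure_univ, mul_one]
  have hjoin : ∀ (C : ι → Set (X × Y)) (D : Set (X × Y)), (∀ j, MeasurableSet (C j)) →
      MeasurableSet D → ρ (D ×ˢ Set.univ.pi C) = m D * ∏ j, m (C j) := by
    intro C D hC hD
    have hE : MeasurableSet (Set.univ.pi C) := MeasurableSet.univ_pi hC
    -- Independence is known for `D = A × B` only; as measures in `D` both sides then agree
    -- everywhere.
    have h1 : (ρ.restrict (Set.univ ×ˢ Set.univ.pi C)).map Prod.fst
        = (Measure.pi (fun _ => m) (Set.univ.pi C)) • m := by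
      refine Measure.ext_prod fun {A B} hA hB => ?_
      rw [Measure.map_apply measurable_fst (hA.prod hB),
        Measure.restrict_apply (measurable_fst (hA.prod hB)), Measure.smul_apply, smul_eq_mul, hm,
        Measure.prod_prod, mul_comm, ← measure_prod_prod_of_invariant hS hcons hQm hρinv hXZ
          (fun A B hA hB => by rw [hXY _ (hA.prod hB), hm, Measure.prod_prod]) hA hB hE
          (MixesSet.pi hRm hmix hC)]
      congr 1
      ext p
      simp
    have h2 := congrArg (fun κ => κ D) h1
    rw [Measure.map_apply measurable_fst hD, Measure.restrict_apply (measurable_fst hD),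
      Measure.smul_apply, smul_eq_mul, Measure.pi_pi, mul_comm] at h2
    rw [← h2]
    congr 1
    ext p
    simp
  symm
  refine Measure.pi_eq fun C hC => ?_
  -- Leaving the substitute point free recovers `ν` from `ρ`.
  have h1 := hjoin (Function.update C i Set.univ) (C i) (hupdm C _ hC MeasurableSet.univ) (hC i)
  rw [hρC _ _ (hupdm C _ hC MeasurableSet.univ) (hC i)] at h1
  have h2 := hupd C Set.univ
  simp only [Function.update_idem, Function.update_eq_self, Function.update_self, measure_univ,
    mul_one, one_mul] at h1 h2
  rw [h1, mul_comm, h2]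

/-- Replace the fibre coordinates indexed by `s` by new ones. -/
def resampleFibres [DecidableEq ι] (s : Finset ι) (p : (ι → X × Y) × (ι → Y)) : ι → X × Y :=
  fun j => if j ∈ s then ((p.1 j).1, p.2 j) else p.1 j

/-- With all fibres resampled independently, the coupling is the product by the base hypothesis.
Original fibres are then restored one by one, each time by `eq_pi_of_forget_fibre`, until none is
resampled. -/
theorem eq_pi_of_base_eq_pi (hS : MeasurePreserving S μ μ)
    (hT : MeasurePreserving T μ' μ')
    (hcons : Conservative (cocycleExtension S n) (μ.prod Measure.count))
    (hmix : ∀ A, MeasurableSet A → MixesSet (skewProduct S T n hn) (μ.prod μ') A)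
    (hν : MeasurePreserving (fun (z : ι → X × Y) j => skewProduct S T n hn (z j)) ν ν)
    (hmarg : ∀ i, MeasurePreserving (fun z : ι → X × Y => z i) ν (μ.prod μ'))
    (hbase : MeasurePreserving (fun (z : ι → X × Y) j => (z j).1) ν (Measure.pi fun _ => μ)) :
    ν = Measure.pi fun _ => μ.prod μ' := by
  classical
  set P : Measure ((ι → X × Y) × (ι → Y)) := ν.prod (Measure.pi fun _ => μ') with hP
  have hmeas : ∀ s : Finset ι, Measurable (resampleFibres s : (ι → X × Y) × (ι → Y) → ι → X × Y) :=
    fun s => measurable_pi_lambda _ fun j => by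
      by_cases hj : j ∈ s <;> simp only [resampleFibres, hj, if_true, if_false] <;> fun_prop
  have hprob : ∀ s : Finset ι, IsProbabilityMeasure (P.map (resampleFibres s)) := fun s =>
    Measure.isProbabilityMeasure_map (hmeas s).aemeasurable
  -- The new fibres are driven by the old base points, which makes resampling commute with the
  -- dynamics.
  have hPinv : MeasurePreserving (fun p : (ι → X × Y) × (ι → Y) =>
      ((fun j => skewProduct S T n hn (p.1 j)),
        fun j => (T.toEquiv ^ n (p.1 j).1 : Equiv.Perm Y) (p.2 j))) P P := by
    refine hν.skew_product
      (g := fun z (w : ι → Y) j => (T.toEquiv ^ n (z j).1 : Equiv.Perm Y) (w j)) ?_ (ae_of_all _ fun z => ?_)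
    · refine measurable_pi_lambda _ fun j => ?_
      have h1 : Measurable fun p : (ι → X × Y) × (ι → Y) => ((p.1 j).1, p.2 j) := by fun_prop
      exact (measurable_zpow_perm_prod T hn).comp h1
    · exact (measurePreserving_pi _ _ fun j => hT.zpow_perm (n (z j).1)).map_eq
  have hinv : ∀ s : Finset ι, MeasurePreserving
      (fun (z : ι → X × Y) j => skewProduct S T n hn (z j)) (P.map (resampleFibres s))
      (P.map (resampleFibres s)) := by
    intro s
    refine MeasurePreserving.of_semiconj (f := resampleFibres s) ⟨hmeas s, rfl⟩ hPinv (fun p => ?_)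
      hν.measurable
    funext j
    by_cases hj : j ∈ s
    · simp only [resampleFibres, hj, if_true]; rfl
    · simp only [resampleFibres, hj, if_false]
  have hmargs : ∀ (s : Finset ι) (i : ι), MeasurePreserving (fun z : ι → X × Y => z i)
      (P.map (resampleFibres s)) (μ.prod μ') := by
    intro s i
    refine MeasurePreserving.map_of_comp ?_ (measurable_pi_apply i) (hmeas s)
    by_cases hi : i ∈ s
    · have h1 := (measurePreserving_fst.comp (hmarg i)).prod
        (measurePreserving_eval (fun _ : ι => μ') i)
      convert h1 using 1
      funext p
      change (if i ∈ s then ((p.1 i).1, p.2 i) else p.1 i) = ((p.1 i).1, p.2 i)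
      rw [if_pos hi]
    · have h1 := (hmarg i).comp
        (measurePreserving_fst (μ := ν) (ν := Measure.pi fun _ : ι => μ'))
      convert h1 using 1
      funext p
      simp [resampleFibres, hi]
  have huniv : P.map (resampleFibres Finset.univ) = Measure.pi fun _ => μ.prod μ' := by
    have h1 := ((measurePreserving_arrowProdEquivProdArrow X Y ι (fun _ => μ) fun _ => μ').symm).comp
      (hbase.prod (MeasurePreserving.id (Measure.pi fun _ : ι => μ')))
    rw [← h1.map_eq]
    congr 1
    funext p j
    simp [resampleFibres]
    rfl
  have hstep : ∀ s : Finset ι, ∀ i ∉ s,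
      P.map (resampleFibres (insert i s)) = (Measure.pi fun _ => μ.prod μ') →
      P.map (resampleFibres s) = Measure.pi fun _ => μ.prod μ' := by
    intro s i hi h
    have := hprob s
    -- A box that ignores the `i`-th fibre cannot tell whether that fibre was resampled.
    refine eq_pi_of_forget_fibre hS hT hcons hmix (hinv s) i (hmargs s i) fun A C hA hC hCi => ?_
    rw [← Measure.pi_pi, ← h, Measure.map_apply (hmeas _) (MeasurableSet.univ_pi hC),
      Measure.map_apply (hmeas _) (MeasurableSet.univ_pi hC)]
    congr 1
    ext p
    simp only [Set.mem_preimage, Set.mem_pi, Set.mem_univ, true_implies]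
    refine forall_congr' fun j => ?_
    by_cases hj : j = i
    · subst hj
      simp [resampleFibres, hi, hCi]
    · simp [resampleFibres, hj]
  have hall : ∀ s : Finset ι, P.map (resampleFibres sᶜ) = Measure.pi fun _ => μ.prod μ' := by
    intro s
    induction s using Finset.induction_on with
    | empty => simpa using huniv
    | insert i s hi ih =>
      refine hstep _ i (by simp) ?_
      rwa [Finset.compl_insert, Finset.insert_erase (by simpa using hi)]
  have h0 := hall Finset.univ
  rw [Finset.compl_univ] at h0
  rw [← h0]
  have h1 : (resampleFibres ∅ : (ι → X × Y) × (ι → Y) → ι → X × Y) = Prod.fst := by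
    funext p j
    simp [resampleFibres]
  rw [h1, hP, (measurePreserving_fst (μ := ν)).map_eq]

end Couplings

/-! ### Compactness of couplings with fixed marginals -/

/-- A union bound whose error depends only on the marginal, hence is uniform over all couplings. -/
theorem measure_univ_pi_le_add {W ι : Type*} [Fintype ι] [MeasurableSpace W] {m : Measure W}
    {ν : Measure (ι → W)} (hmarg : ∀ i, MeasurePreserving (fun z : ι → W => z i) ν m)
    {C D : ι → Set W} (hC : ∀ i, MeasurableSet (C i)) (hD : ∀ i, MeasurableSet (D i)) :
    ν (Set.univ.pi D) ≤ ν (Set.univ.pi C) + ∑ i, m (D i \ C i) := by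
  have h1 : Set.univ.pi D ⊆ Set.univ.pi C ∪ ⋃ i, (fun z : ι → W => z i) ⁻¹' (D i \ C i) := by
    intro z hz
    by_cases h : z ∈ Set.univ.pi C
    · exact Or.inl h
    · simp only [Set.mem_pi, Set.mem_univ, true_implies, not_forall] at h
      obtain ⟨i, hi⟩ := h
      exact Or.inr (Set.mem_iUnion.2 ⟨i, hz i (Set.mem_univ i), hi⟩)
  refine (measure_mono h1).trans ((measure_union_le _ _).trans ?_)
  gcongr
  refine (measure_iUnion_fintype_le _ _).trans (le_of_eq (Finset.sum_congr rfl fun i _ => ?_))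
  exact (hmarg i).measure_preimage ((hD i).diff (hC i)).nullMeasurableSet

/-- Couplings with fixed marginals on a standard Borel space are compact for the convergence on
measurable rectangles. -/
theorem exists_tendsto_univ_pi {W ι κ : Type*} [Fintype ι] [MeasurableSpace W]
    [StandardBorelSpace W] {m : Measure W} [IsProbabilityMeasure m] {ν : κ → Measure (ι → W)}
    [∀ k, IsProbabilityMeasure (ν k)]
    (hmarg : ∀ k i, MeasurePreserving (fun z : ι → W => z i) (ν k) m) (U : Ultrafilter κ) :
    ∃ p : Measure (ι → W), IsProbabilityMeasure p ∧
      ∀ C : ι → Set W, (∀ i, MeasurableSet (C i)) →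
        Tendsto (fun k => ν k (Set.univ.pi C)) U (𝓝 (p (Set.univ.pi C))) := by
  let := upgradeStandardBorel W
  let := TopologicalSpace.upgradeIsCompletelyMetrizable W
  have hsmall : ∀ ε : NNReal, 0 < ε →
      ∃ δ : ι → NNReal, (∀ i, 0 < δ i) ∧ ∑ i, (δ i : ENNReal) ≤ ε := by
    intro ε hε
    obtain ⟨δ, h1, h2⟩ := ENNReal.exists_pos_sum_of_countable (ε := (ε : ENNReal))
      (by exact_mod_cast hε.ne') ι
    rw [tsum_fintype] at h2
    exact ⟨δ, h1, h2.le⟩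
  set P : κ → ProbabilityMeasure (ι → W) := fun k => ⟨ν k, inferInstance⟩ with hP
  -- Products of compact sets that are nearly full for `m` serve every coupling at once.
  have htight : IsTightMeasureSet {((μ : ProbabilityMeasure (ι → W)) : Measure (ι → W)) |
      μ ∈ Set.range P} := by
    rw [isTightMeasureSet_iff_exists_isCompact_measure_compl_le]
    intro ε hε
    obtain ⟨ε', hε'0, hε'⟩ := ENNReal.lt_iff_exists_nnreal_btwn.1 hε
    obtain ⟨δ, hδ0, hδ⟩ := hsmall ε' (by exact_mod_cast hε'0)
    have hK : ∀ i, ∃ K : Set W, IsCompact K ∧ m Kᶜ ≤ δ i := fun i => by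
      obtain ⟨K, hK1, hK2⟩ := isTightMeasureSet_iff_exists_isCompact_measure_compl_le.1
        (isTightMeasureSet_singleton (μ := m)) (δ i) (by exact_mod_cast hδ0 i)
      exact ⟨K, hK1, hK2 m rfl⟩
    choose K hKc hKm using hK
    refine ⟨Set.univ.pi K, isCompact_univ_pi hKc, ?_⟩
    rintro _ ⟨_, ⟨k, rfl⟩, rfl⟩
    change ν k _ ≤ ε
    have h1 : (Set.univ.pi K)ᶜ ⊆ ⋃ i, (fun z : ι → W => z i) ⁻¹' (K i)ᶜ := by
      intro z hz
      simpa [Set.mem_pi] using hz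
    refine (measure_mono h1).trans ((measure_iUnion_fintype_le _ _).trans ?_)
    refine le_trans (Finset.sum_le_sum fun i _ => ?_) (hδ.trans hε'.le)
    rw [(hmarg k i).measure_preimage (hKc i).measurableSet.compl.nullMeasurableSet]
    exact hKm i
  obtain ⟨p, -, hp⟩ := isCompact_iff_ultrafilter_le_nhds.1
    (isCompact_closure_of_isTightMeasureSet htight) (U.map P) (by
      rw [le_principal_iff]
      exact mem_of_superset (Filter.mem_map.2 (univ_mem' fun k => Set.mem_range_self k))
        subset_closure)
  have hp' : Tendsto P U (𝓝 p) := hp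
  refine ⟨p, inferInstance, fun C hC => ?_⟩
  have hlim : ∀ f : κ → ENNReal, ∃ L, Tendsto f U (𝓝 L) := fun f => by
    obtain ⟨L, -, hL⟩ := isCompact_univ.ultrafilter_le_nhds (U.map f) (by simp)
    exact ⟨L, hL⟩
  have hopen : ∀ (A : Set W), MeasurableSet A → ∀ δ : NNReal, 0 < δ →
      ∃ O, A ⊆ O ∧ IsOpen O ∧ m (O \ A) ≤ δ := fun A hA δ hδ => by
    obtain ⟨O, h1, h2, -, h3⟩ := hA.exists_isOpen_sdiff_lt (μ := m) (measure_ne_top _ _)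
      (ε := (δ : ENNReal)) (by exact_mod_cast hδ.ne')
    exact ⟨O, h1, h2, h3.le⟩
  obtain ⟨L, hL⟩ := hlim fun k => ν k (Set.univ.pi C)
  suffices h : L = (p : Measure (ι → W)) (Set.univ.pi C) by rwa [← h]
  -- Weak convergence controls closed sets from above and open sets from below: approximate the
  -- sides of the box from inside, then from outside, up to small `m`-measure.
  refine le_antisymm (ENNReal.le_of_forall_pos_le_add fun ε hε _ => ?_)
    (ENNReal.le_of_forall_pos_le_add fun ε hε _ => ?_)
  · obtain ⟨δ, hδ0, hδ⟩ := hsmall ε hε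
    choose O hO1 hO2 hO3 using fun i => hopen (C i)ᶜ (hC i).compl (δ i) (hδ0 i)
    obtain ⟨L', hL'⟩ := hlim fun k => ν k (Set.univ.pi fun i => (O i)ᶜ)
    have h1 : L' ≤ (p : Measure (ι → W)) (Set.univ.pi C) := by
      have h2 := ProbabilityMeasure.limsup_measure_closed_le_of_tendsto hp'
        (isClosed_set_pi (s := fun i => (O i)ᶜ) fun i (_ : i ∈ Set.univ) => (hO2 i).isClosed_compl)
      rw [← hL'.limsup_eq]
      refine h2.trans (measure_mono (Set.pi_mono fun i _ => ?_))
      exact Set.compl_subset_comm.1 (hO1 i)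
    refine (le_of_tendsto_of_tendsto' hL (hL'.add_const (ε : ENNReal)) fun k => ?_).trans
      (add_le_add_left h1 _)
    refine (measure_univ_pi_le_add (hmarg k) (C := fun i => (O i)ᶜ)
      (fun i => (hO2 i).measurableSet.compl) hC).trans ?_
    gcongr
    refine le_trans (Finset.sum_le_sum fun i _ => ?_) hδ
    refine le_trans (measure_mono ?_) (hO3 i)
    intro w hw
    simp only [Set.mem_sdiff, Set.mem_compl_iff, not_not] at hw ⊢
    exact ⟨hw.2, hw.1⟩
  · obtain ⟨δ, hδ0, hδ⟩ := hsmall ε hε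
    choose O hO1 hO2 hO3 using fun i => hopen (C i) (hC i) (δ i) (hδ0 i)
    obtain ⟨L', hL'⟩ := hlim fun k => ν k (Set.univ.pi O)
    have h1 : (p : Measure (ι → W)) (Set.univ.pi C) ≤ L' := by
      have h2 := ProbabilityMeasure.le_liminf_measure_open_of_tendsto hp'
        (isOpen_set_pi (s := O) Set.finite_univ fun i _ => hO2 i)
      rw [← hL'.liminf_eq]
      exact (measure_mono (Set.pi_mono fun i _ => hO1 i)).trans h2
    refine h1.trans (le_of_tendsto_of_tendsto' hL' (hL.add_const (ε : ENNReal)) fun k => ?_)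
    refine (measure_univ_pi_le_add (hmarg k) hC fun i => (hO2 i).measurableSet).trans ?_
    gcongr
    exact le_trans (Finset.sum_le_sum fun i _ => hO3 i) hδ

/-! ### Passage to the base and the two assertions -/

theorem mixesSet_base_of_skewProduct {X Y : Type*} [MeasurableSpace X] [MeasurableSpace Y]
    {μ : Measure X} [IsProbabilityMeasure μ] {μ' : Measure Y} [IsProbabilityMeasure μ']
    {S : X ≃ᵐ X} {T : Y ≃ᵐ Y} {n : X → ℤ} {hn : Measurable n}
    (hmix : ∀ A, MeasurableSet A → MixesSet (skewProduct S T n hn) (μ.prod μ') A)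
    (A : Set X) (hA : MeasurableSet A) : MixesSet S μ A := by
  intro B hB
  have h := hmix (A ×ˢ Set.univ) (hA.prod MeasurableSet.univ) (B ×ˢ Set.univ)
    (hB.prod MeasurableSet.univ)
  have hreal : ∀ C : Set X, (μ.prod μ').real (C ×ˢ Set.univ) = μ.real C := fun C => by
    simp [Measure.real]
  rw [hreal, hreal] at h
  refine h.congr fun k => ?_
  rw [← hreal]
  congr 1
  ext p
  simp [skewProduct_iterate]

section Main

variable {X Y : Type*} [MeasurableSpace X] [StandardBorelSpace X] [MeasurableSpace Y]
  [StandardBorelSpace Y] {μ : Measure X} [IsProbabilityMeasure μ] {μ' : Measure Y}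
  [IsProbabilityMeasure μ'] {S : X ≃ᵐ X} {T : Y ≃ᵐ Y} {n : X → ℤ} {hn : Measurable n}

theorem mixesWithMultiplicity_skewProduct (hS : MeasurePreserving S μ μ)
    (hT : MeasurePreserving T μ' μ')
    (hcons : Conservative (cocycleExtension S n) (μ.prod Measure.count))
    (hmix : ∀ A, MeasurableSet A → MixesSet (skewProduct S T n hn) (μ.prod μ') A) {k : ℕ}
    (hk : MixesWithMultiplicity S μ k) :
    MixesWithMultiplicity (skewProduct S T n hn) (μ.prod μ') k := by
  intro A l hA hl
  set R := skewProduct S T n hn with hR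
  set m := μ.prod μ' with hm
  have hRm : MeasurePreserving R m m := measurePreserving_skewProduct hS hT hn
  have hRm' : MeasurePreserving R.symm m m := hRm.symm R
  set e : Fin (k + 1) → ℕ → ℕ := fun i j =>
    ∑ t ∈ Finset.univ.filter (fun t : Fin k => (t : ℕ) < (i : ℕ)), l t j with he
  -- The law of these orbit tuples gives a box exactly the measure of the intersection in the
  -- definition of multiple mixing.
  set d : ℕ → X × Y → Fin (k + 1) → X × Y := fun j z i => R.symm^[e i j] z with hd
  have hdm : ∀ j, Measurable (d j) := fun j =>
    measurable_pi_lambda _ fun i => R.symm.measurable.iterate _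
  set ν : ℕ → Measure (Fin (k + 1) → X × Y) := fun j => m.map (d j) with hνdef
  have hνC : ∀ (j : ℕ) (C : Fin (k + 1) → Set (X × Y)), (∀ i, MeasurableSet (C i)) →
      ν j (Set.univ.pi C) = m (⋂ i, R^[e i j] '' C i) := by
    intro j C hC
    rw [hνdef, Measure.map_apply (hdm j) (MeasurableSet.univ_pi hC)]
    congr 1
    ext z
    simp [hd, image_iterate_eq_preimage]
  have hνprob : ∀ j, IsProbabilityMeasure (ν j) := fun j =>
    Measure.isProbabilityMeasure_map (hdm j).aemeasurable
  have hνmarg : ∀ j i, MeasurePreserving (fun z : Fin (k + 1) → X × Y => z i) (ν j) m :=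
    fun j i => MeasurePreserving.map_of_comp (hRm'.iterate (e i j)) (measurable_pi_apply i) (hdm j)
  have hRpi : Measurable fun (z : Fin (k + 1) → X × Y) i => R (z i) :=
    measurable_pi_lambda _ fun i => R.measurable.comp (measurable_pi_apply i)
  have hνinv : ∀ j, MeasurePreserving (fun (z : Fin (k + 1) → X × Y) i => R (z i)) (ν j) (ν j) := by
    intro j
    refine MeasurePreserving.of_semiconj (f := d j) ⟨hdm j, rfl⟩ hRm (fun z => ?_) hRpi
    funext i
    have h1 : Function.Commute R.symm R := fun z => by simp
    exact (h1.iterate_left (e i j)) z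
  have hgoal : (fun j => m (⋂ i, R^[e i j] '' A i)) = fun j => ν j (Set.univ.pi A) :=
    funext fun j => (hνC j A hA).symm
  change Tendsto (fun j => m (⋂ i, R^[e i j] '' A i)) atTop _
  -- It suffices that the limit coupling along every ultrafilter is the product.
  rw [hgoal, tendsto_iff_ultrafilter]
  intro U hU
  obtain ⟨p, hp, hpU⟩ := exists_tendsto_univ_pi hνmarg U
  suffices h : p = Measure.pi fun _ => m by
    have h1 := hpU A hA
    rwa [h, Measure.pi_pi] at h1
  have hpmarg : ∀ i, MeasurePreserving (fun z : Fin (k + 1) → X × Y => z i) p m := by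
    intro i
    refine ⟨measurable_pi_apply i, Measure.ext fun D hD => ?_⟩
    rw [Measure.map_apply (measurable_pi_apply i) hD]
    have h1 : (fun z : Fin (k + 1) → X × Y => z i) ⁻¹' D
        = Set.univ.pi (Function.update (fun _ => Set.univ) i D) := by
      rw [Set.univ_pi_update_univ]
    have h2 : ∀ i', MeasurableSet (Function.update (fun _ => Set.univ) i D i') := fun i' => by
      by_cases h : i' = i
      · subst h; simpa using hD
      · simp [h]
    rw [h1]
    refine tendsto_nhds_unique (hpU _ h2) (tendsto_const_nhds.congr fun j => ?_)
    rw [← h1, (hνmarg j i).measure_preimage hD.nullMeasurableSet]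
  have hpinv : MeasurePreserving (fun (z : Fin (k + 1) → X × Y) i => R (z i)) p p := by
    refine ⟨hRpi, ?_⟩
    have := Measure.isProbabilityMeasure_map (μ := p) hRpi.aemeasurable
    refine ext_of_generate_finite _ generateFrom_pi.symm isPiSystem_pi ?_ (by simp)
    rintro _ ⟨C, hC, rfl⟩
    have hC' : ∀ i, MeasurableSet (C i) := fun i => hC i (Set.mem_univ i)
    rw [Measure.map_apply hRpi (MeasurableSet.univ_pi hC')]
    refine tendsto_nhds_unique (hpU (fun i => R ⁻¹' C i) fun i => R.measurable (hC' i))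
      ((hpU C hC').congr fun j => ?_)
    exact ((hνinv j).measure_preimage (MeasurableSet.univ_pi hC').nullMeasurableSet).symm
  have hbm : Measurable fun (z : Fin (k + 1) → X × Y) j => (z j).1 := by fun_prop
  have hpbase : MeasurePreserving (fun (z : Fin (k + 1) → X × Y) j => (z j).1) p
      (Measure.pi fun _ => μ) := by
    refine ⟨hbm, (Measure.pi_eq fun B hB => ?_).symm⟩
    rw [Measure.map_apply hbm (MeasurableSet.univ_pi hB)]
    have h1 := hpU (fun i => B i ×ˢ Set.univ) fun i => (hB i).prod MeasurableSet.univ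
    have h2 : (fun (z : Fin (k + 1) → X × Y) j => (z j).1) ⁻¹' Set.univ.pi B
        = Set.univ.pi fun i => B i ×ˢ Set.univ := by
      ext z; simp
    rw [h2]
    refine tendsto_nhds_unique h1 (((hk B l hB hl).mono_left hU).congr fun j => ?_)
    have h3 : ∀ r (z : X × Y), (R.symm^[r] z).1 = S.symm^[r] z.1 := fun r z => by
      have : Function.Semiconj Prod.fst R.symm S.symm := fun _ => rfl
      exact (this.iterate_right r) z
    rw [hνC j _ fun i => (hB i).prod MeasurableSet.univ]
    have h4 : (⋂ i, R^[e i j] '' (B i ×ˢ Set.univ))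
        = (⋂ i, S^[e i j] '' B i) ×ˢ (Set.univ : Set Y) := by
      ext z
      simp [image_iterate_eq_preimage, h3]
    rw [h4, hm, Measure.prod_prod, measure_univ, mul_one]
  exact eq_pi_of_base_eq_pi hS hT hcons hmix hpinv hpmarg hpbase

theorem tensorSimple_skewProduct (hS : MeasurePreserving S μ μ)
    (hT : MeasurePreserving T μ' μ')
    (hcons : Conservative (cocycleExtension S n) (μ.prod Measure.count))
    (hmix : ∀ A, MeasurableSet A → MixesSet (skewProduct S T n hn) (μ.prod μ') A)
    (hsimple : TensorSimple S μ) : TensorSimple (skewProduct S T n hn) (μ.prod μ') := by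
  intro N hN ν hν hνinv
  -- As `N ≥ 2`, each coordinate lies in an `(N-1)`-face, so the faces determine the one-dimensional
  -- marginals and the total mass.
  have hrestr : ∀ i : Fin N, ∃ s : Finset (Fin N), s.card = N - 1 ∧ i ∈ s := by
    intro i
    have : Nontrivial (Fin N) := Fin.nontrivial_iff_two_le.2 hN.le
    obtain ⟨j, hj⟩ := exists_ne i
    exact ⟨Finset.univ.erase j, by simp, by simp [hj.symm]⟩
  have hmp : ∀ s : Finset (Fin N), s.card = N - 1 →
      MeasurePreserving s.restrict ν (Measure.pi fun _ : s => μ.prod μ') := fun s hs =>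
    ⟨Finset.measurable_restrict s, hν s hs⟩
  have hprob : IsProbabilityMeasure ν := by
    obtain ⟨s, hs, -⟩ := hrestr ⟨0, by omega⟩
    constructor
    rw [← Set.preimage_univ (f := s.restrict), (hmp s hs).measure_preimage
      MeasurableSet.univ.nullMeasurableSet, measure_univ]
  have hmarg : ∀ i, MeasurePreserving (fun z : Fin N → X × Y => z i) ν (μ.prod μ') := by
    intro i
    obtain ⟨s, hs, hi⟩ := hrestr i
    exact (measurePreserving_eval (fun _ : s => μ.prod μ') ⟨i, hi⟩).comp (hmp s hs)
  have hbm : Measurable fun (z : Fin N → X × Y) j => (z j).1 := by fun_prop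
  refine eq_pi_of_base_eq_pi hS hT hcons hmix hνinv hmarg ⟨hbm, ?_⟩
  -- Faces of the base projection are base projections of faces, so tensor simplicity of `S` applies
  -- to it.
  refine hsimple N hN _ (fun s hs => ?_) ?_
  · rw [Measure.map_map (Finset.measurable_restrict s) hbm]
    exact ((measurePreserving_pi _ _ fun _ : s =>
      measurePreserving_fst (μ := μ) (ν := μ')).comp (hmp s hs)).map_eq
  · exact MeasurePreserving.of_semiconj ⟨hbm, rfl⟩ hνinv (fun _ => rfl)
      (measurable_pi_lambda _ fun i => S.measurable.comp (measurable_pi_apply i))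

end Main

theorem mainTheorem12 {X Y : Type*}
    [MeasurableSpace X] [StandardBorelSpace X] [MeasurableSpace Y] [StandardBorelSpace Y]
    (μ : Measure X) [IsProbabilityMeasure μ] (μ' : Measure Y) [IsProbabilityMeasure μ']
    (S : X ≃ᵐ X) (hS : MeasurePreserving S μ μ)
    (T : Y ≃ᵐ Y) (hT : MeasurePreserving T μ' μ')
    (n : X → ℤ) (hn : Measurable n)
    (hint : Integrable (fun x => (n x : ℝ)) μ) (hzero : ∫ x, (n x : ℝ) ∂μ = 0)
    (hTmix : IsMixing T μ') (hRmix : IsMixing (skewProduct S T n hn) (μ.prod μ')) :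
    (∀ k : ℕ, MixesWithMultiplicity S μ k →
      MixesWithMultiplicity (skewProduct S T n hn) (μ.prod μ') k) ∧
    (TensorSimple S μ → TensorSimple (skewProduct S T n hn) (μ.prod μ')) := by
  have hmix : ∀ A, MeasurableSet A → MixesSet (skewProduct S T n hn) (μ.prod μ') A := fun A hA =>
    hRmix.mixesSet (measurePreserving_skewProduct hS hT hn) hA
  have hcons := conservative_cocycleExtension hS (mixesSet_base_of_skewProduct hmix) hn hint hzero
  exact ⟨fun k hk => mixesWithMultiplicity_skewProduct hS hT hcons hmix hk,
    tensorSimple_skewProduct hS hT hcons hmix⟩
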